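/- Let $d,q\ge 0$ be integers, let $U\subseteq\mathbb R^d$ be compact and convex, and let $S:U\rightrightarrows\mathbb R^q$ have nonempty compact convex values and be Lipschitz, i.e. for some $\kappa\ge 0$, $S(x')\subseteq S(x)+\kappa\|x'-x\|\,\mathbb B$ for all $x,x'\in U$, where $\mathbb B$ is the closed unit ball. Let $X_1,X_2,\dots$ be i.i.d. random vectors in $U$ whose law has a density $f_X$ on $U$ with respect to Lebesgue measure that is Lipschitz continuous on $U$ and satisfies $f_X(u)>0$ for all $u\in U$. Let $W_1,W_2,\dots$ be i.i.d. random vectors in $\mathbb R^q$ with $\mathbb E W_i=0$ and $\mathbb E\|W_i\|^2<\infty$, and let the sequence $(W_i)$ be independent of the sequence $(X_i)$. One observes $X_i$ and $S_i=S(X_i)\oplus W_i$, where $\oplus$ is the Minkowski sum. Let $\varphi:\mathbb R\to\mathbb R$ be a kernel: measurable, non-negative, bounded and even, and such that for some $\eta\in(0,1)$, $\varphi(t)>0$ for $|t|\le\eta$ and $\varphi(t)=0$ for $|t|\ge 1$. Put $\varphi_h(x)=h^{-d}\varphi(\|x\|/h)$ for $x\in\mathbb R^d$, and $\gamma(u)=\int_{T_U(u)}\varphi_1(z)\,dz$,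 where $T_U(u)$ is the tangent cone of $U$ at $u$. With $h=h_n=n^{-1/(d+4)}$ define $$\widehat S_n(u)=\Big[\tfrac1n\sum_{i=1}^n\varphi_h(X_i-u)\Big]^{-1}\cdot\Big[\tfrac1n\bigoplus_{i=1}^n\varphi_h(X_i-u)\cdot S_i\Big].$$ Then for each $u\in U$ the following hold almost surely as $n\to\infty$: 1. $\frac1n\sum_{i=1}^n\varphi_h(X_i-u)\to\gamma(u)f_X(u)$; 2. $\frac1n\sum_{i=1}^n\varphi_h(X_i-u)\,W_i\to 0$; 3. $\frac1n\sum_{i=1}^n\varphi_h(X_i-u)\,\|X_i-u\|\to 0$; 4. $\widehat S_n(u)\to S(u)$ in the sense of Painlevé–Kuratowski, i.e. $\limsup_n\widehat S_n(u)=\liminf_n\widehat S_n(u)=S(u)$, where for sets $C_n$ the outer limit $\limsup_n C_n$ is the set of limits of sequences $x_{n_k}\in C_{n_k}$ along subsequences, and the inner limit $\liminf_n C_n$ is the set of limits of sequences $(x_n)$ with $x_n\in C_n$ for all large $n$. -/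

import Mathlib

open MeasureTheory ProbabilityTheory Filter Topology
open scoped NNReal ENNReal Pointwise

namespace SetRegression

/-- Outer limit of a sequence of sets: the limits of convergent subsequences
`x k ∈ C (n k)`. -/
def outerLimit {E : Type*} [TopologicalSpace E] (C : ℕ → Set E) : Set E :=
  {x | ∃ n : ℕ → ℕ, StrictMono n ∧ ∃ y : ℕ → E, (∀ k, y k ∈ C (n k)) ∧ Tendsto y atTop (𝓝 x)}

/-- Inner limit of a sequence of sets: the limits of sequences `y n` with `y n ∈ C n` for all
large `n`. -/
def innerLimit {E : Type*} [TopologicalSpace E] (C : ℕ → Set E) : Set E :=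
  {x | ∃ y : ℕ → E, (∀ᶠ n in atTop, y n ∈ C n) ∧ Tendsto y atTop (𝓝 x)}

/-- `C n` converges to `L` in the sense of Painlevé and Kuratowski. -/
def SetTendsto {E : Type*} [TopologicalSpace E] (C : ℕ → Set E) (L : Set E) : Prop :=
  outerLimit C = L ∧ innerLimit C = L

/-- The set-valued function `S` is Lipschitz continuous on `U` with constant `κ`: its values on `U`
are nonempty and closed, and `S x' ⊆ S x + κ ‖x' - x‖ 𝔹` for `x, x' ∈ U`. -/
structure SetLipschitzOn {E F : Type*} [NormedAddCommGroup E] [NormedAddCommGroup F]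
    [NormedSpace ℝ F] (S : E → Set F) (U : Set E) (κ : ℝ) : Prop where
  const_nonneg : 0 ≤ κ
  nonempty : ∀ x ∈ U, (S x).Nonempty
  closed : ∀ x ∈ U, IsClosed (S x)
  subset : ∀ x ∈ U, ∀ x' ∈ U, S x' ⊆ S x + (κ * ‖x' - x‖) • Metric.closedBall (0 : F) 1

/-- Kernel functions on the real line. -/
structure IsKernel (φ : ℝ → ℝ) : Prop where
  measurable : Measurable φ
  nonneg : ∀ t, 0 ≤ φ t
  bounded : ∃ M : ℝ, ∀ t, φ t ≤ M
  even : ∀ t, φ (-t) = φ t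
  support : ∃ η : ℝ, 0 < η ∧ η < 1 ∧ (∀ t, |t| ≤ η → 0 < φ t) ∧ ∀ t, 1 ≤ |t| → φ t = 0

/-- The rescaled kernel `φ_h(x) = h^{-d} φ(‖x‖ / h)` on `ℝ^d`. -/
noncomputable def scaledKernel {d : ℕ} (φ : ℝ → ℝ) (h : ℝ) (x : EuclideanSpace ℝ (Fin d)) : ℝ :=
  (h ^ d)⁻¹ * φ (‖x‖ / h)

/-- The bandwidth `h = n^{-1/(d+4)}`. -/
noncomputable def bandwidth (d n : ℕ) : ℝ := (n : ℝ) ^ (-1 / ((d : ℝ) + 4))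

/-- `γ(u) = ∫_{T_U(u)} φ_1(z) dz`. Over the scalars `ℝ≥0` the tangent cone `tangentConeAt` is the
one-sided (Bouligand) cone `T_U(u)`: the limits of `c_n • d_n` with `c_n ≥ 0`, `u + d_n ∈ U`,
`d_n → 0`. -/
noncomputable def kernelMass {d : ℕ} (φ : ℝ → ℝ) (U : Set (EuclideanSpace ℝ (Fin d)))
    (u : EuclideanSpace ℝ (Fin d)) : ℝ :=
  ∫ z in tangentConeAt ℝ≥0 U u, scaledKernel φ 1 z

/-- The kernel regression estimate at the point `u` from the first `n` design points `x i` and the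
first `n` observed sets `s i`, with bandwidth `h`. The sums and the multiplications of sets by
scalars are the Minkowski ones. -/
noncomputable def kernelEstimate {d q : ℕ} (φ : ℝ → ℝ) (h : ℝ) (n : ℕ)
    (x : ℕ → EuclideanSpace ℝ (Fin d)) (s : ℕ → Set (EuclideanSpace ℝ (Fin q)))
    (u : EuclideanSpace ℝ (Fin d)) : Set (EuclideanSpace ℝ (Fin q)) :=
  ((n : ℝ)⁻¹ * ∑ i ∈ Finset.range n, scaledKernel φ h (x i - u))⁻¹ •
    ((n : ℝ)⁻¹ • ∑ i ∈ Finset.range n, scaledKernel φ h (x i - u) • s i)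

end SetRegression

/-!
Each of the four limits is a statement about sums over a triangular array, since the
bandwidth, hence every weight `φ_h(X i - u)`, changes with `n`. With `h = n^{-1/(d+4)}` the
effective sample size is `n h^d = r²`, where `r = n^{2/(d+4)}` (`effectiveRate`), and everything
is driven by one strong law (`ae_tendsto_sum_zero`): if the `n`-th row consists of `n` independent
centred variables bounded by `B / r` with variances at most `C / (n r²)`, its sum tends to zero
almost surely. Chernoff's bound with parameter proportional to `r` gives tails of order
`exp (-s r)`, which are summable.

*Density.* The summands of `(1/n) ∑ φ_h(X i - u)` are at most `M / r²`, with second moments of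
order `1 / (n r²)`, so the average is asymptotic to its mean. Substituting `x = u + h z`, this
mean is `∫ 1_U(u + h z) f(u + h z) φ(‖z‖) dz`. By convexity `u + h z ∈ U` for all small `h`
exactly when `z` lies in the radial cone of `U` at `u`, and dominated convergence gives the limit
over that cone. The tangent cone lies between the radial cone, which is convex, and its closure,
so the two cones differ by a null set (`tangentConeAt_ae_eq_radialCone`).

*Noise.* Only the second moment is available. The `i`-th noise variable is truncated at `r_{i+1}`,
a level that depends on `i` and not on `n`; with weights at most `M / r²` the truncated and
centred array satisfies the strong law above. The `i`-th term occurs only in rows `n ≥ i + 1`, and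
there it has weight zero unless `‖X i - u‖ < h_n ≤ h_{i+1}`. So truncation matters only if
`‖X i - u‖ < h_{i+1}` and `|V i| ≥ r_{i+1}`. These two events are independent, and the
probabilities that both occur sum to at most a constant times `∑ h_k^d P(V² ≥ r_k²)`. This is
finite because the sum of `h_k^d` over the `k` with `r_k² ≤ y` is at most `(d+4)/4 · y`
(`ae_eventually_abs_lt_of_near`). The means of the truncated variables tend to zero, and
Toeplitz's lemma removes them.

*Sets.* The weights being nonnegative, selections from `S (X i)` are replaced by selections from
`S u`, and conversely, at a cost `κ ‖X i - u‖`; by convexity weighted averages of points of `S u`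
stay in `S u`. So the estimate and `S u` are within a distance `δ n → 0` of each other, provided
that the limit `γ(u) f(u)` of the normalization is positive (`kernelMass_pos`).
-/

namespace SetRegression

/-! ### Weighted sums and the strong law for triangular arrays -/

/-- Toeplitz's lemma for nonnegative weights of bounded total mass. -/
theorem tendsto_weighted_sum_zero {w : ℕ → ℕ → ℝ} {a : ℕ → ℝ} {C : ℝ}
    (hw : ∀ n i, 0 ≤ w n i) (hC : ∀ᶠ n in atTop, ∑ i ∈ Finset.range n, w n i ≤ C)
    (hw0 : ∀ i, Tendsto (fun n => w n i) atTop (𝓝 0)) (ha : Tendsto a atTop (𝓝 0)) :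
    Tendsto (fun n => ∑ i ∈ Finset.range n, w n i * a i) atTop (𝓝 0) := by
  rw [Metric.tendsto_atTop']
  intro ε hε
  have hδ : 0 < ε / (2 * (|C| + 1)) := by positivity
  set δ := ε / (2 * (|C| + 1)) with hδdef
  obtain ⟨N, hN⟩ := Metric.tendsto_atTop.1 ha δ hδ
  have hfin : Tendsto (fun n => ∑ i ∈ Finset.range N, w n i * |a i|) atTop (𝓝 0) := by
    have := tendsto_finsetSum (Finset.range N) fun i _ => (hw0 i).mul_const |a i|
    simpa using this
  have hev := (hfin.eventually (gt_mem_nhds (half_pos hε))).and (hC.and (eventually_ge_atTop N))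
  obtain ⟨n₀, hn₀⟩ := eventually_atTop.1 hev
  refine ⟨n₀, fun n hn => ?_⟩
  obtain ⟨h1, h2, h3⟩ := hn₀ n hn.le
  have hδC : δ * C < ε / 2 := by
    have : δ * (|C| + 1) = ε / 2 := by rw [hδdef]; field_simp
    nlinarith [le_abs_self C]
  rw [Real.dist_eq, sub_zero]
  calc |∑ i ∈ Finset.range n, w n i * a i|
      ≤ ∑ i ∈ Finset.range n, w n i * |a i| := by
        refine (Finset.abs_sum_le_sum_abs _ _).trans (le_of_eq ?_)
        simp [abs_mul, abs_of_nonneg (hw n _)]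
    _ ≤ ∑ i ∈ Finset.range n, ((if i < N then w n i * |a i| else 0) + δ * w n i) := by
        refine Finset.sum_le_sum fun i _ => ?_
        split_ifs with hi
        · have := mul_nonneg hδ.le (hw n i); linarith
        · have := hN i (not_lt.1 hi)
          rw [Real.dist_eq, sub_zero] at this
          nlinarith [hw n i]
    _ = ∑ i ∈ Finset.range N, w n i * |a i| + δ * ∑ i ∈ Finset.range n, w n i := by
        rw [Finset.sum_add_distrib, Finset.mul_sum, ← Finset.sum_filter]
        congr 2
        ext i; simp only [Finset.mem_filter, Finset.mem_range]; omega
    _ < ε := by nlinarith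

section Chernoff

variable {Ω : Type*} [MeasurableSpace Ω] {P : Measure Ω} [IsProbabilityMeasure P]

/-- A Bernstein-type bound: as long as `t Y` stays in `[-1, 1]`, where `e^x ≤ 1 + x + x²`, the
moment generating function of a centred variable is controlled by the variance alone. -/
theorem mgf_le_exp_sq_mul {Y : Ω → ℝ} {b t v : ℝ} (hY : Measurable Y) (hb : ∀ ω, |Y ω| ≤ b)
    (hmean : ∫ ω, Y ω ∂P = 0) (hvar : ∫ ω, Y ω ^ 2 ∂P ≤ v) (ht : |t| * b ≤ 1) :
    mgf Y P t ≤ Real.exp (t ^ 2 * v) := by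
  have hYb : ∀ ω, |t * Y ω| ≤ 1 := fun ω => by
    rw [abs_mul]; exact (mul_le_mul_of_nonneg_left (hb ω) (abs_nonneg t)).trans ht
  have hYint : Integrable Y P :=
    .of_bound hY.aestronglyMeasurable b (.of_forall hb)
  have hY2int : Integrable (fun ω => Y ω ^ 2) P := by
    refine .of_bound (hY.pow_const 2).aestronglyMeasurable (b ^ 2) (.of_forall fun ω => ?_)
    rw [Real.norm_eq_abs, abs_pow]
    exact pow_le_pow_left₀ (abs_nonneg _) (hb ω) 2
  have hI : Integrable (fun ω => t * Y ω + t ^ 2 * Y ω ^ 2) P :=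
    (hYint.const_mul t).add (hY2int.const_mul (t ^ 2))
  calc mgf Y P t ≤ ∫ ω, (1 + (t * Y ω + t ^ 2 * Y ω ^ 2)) ∂P := by
        refine integral_mono_of_nonneg (.of_forall fun ω => (Real.exp_pos _).le)
          ((integrable_const 1).add hI) (.of_forall fun ω => ?_)
        have := (abs_le.1 (Real.abs_exp_sub_one_sub_id_le (hYb ω))).2
        simp only
        nlinarith
    _ = 1 + t ^ 2 * ∫ ω, Y ω ^ 2 ∂P := by
        rw [integral_add (integrable_const 1) hI,
          integral_add (hYint.const_mul t) (hY2int.const_mul (t ^ 2)),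
          integral_const_mul, integral_const_mul, hmean]
        simp
    _ ≤ 1 + t ^ 2 * v := by gcongr
    _ ≤ Real.exp (t ^ 2 * v) := by rw [add_comm]; exact Real.add_one_le_exp _

/-- The upper half of the strong law for triangular arrays, by Chernoff's bound and
Borel–Cantelli. -/
theorem ae_eventually_sum_lt {r : ℕ → ℝ} (hr : ∀ n, 1 ≤ n → 0 < r n)
    (hsum : ∀ s > 0, Summable fun n => Real.exp (-(s * r n)))
    {Z : ℕ → ℕ → Ω → ℝ} (hZ : ∀ n i, Measurable (Z n i)) (hind : ∀ n, iIndepFun (Z n) P)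
    {B C : ℝ} (hB : ∀ n i, i < n → ∀ ω, |Z n i ω| ≤ B / r n)
    (hmean : ∀ n i, i < n → ∫ ω, Z n i ω ∂P = 0)
    (hvar : ∀ n i, i < n → ∫ ω, Z n i ω ^ 2 ∂P ≤ C / (n * r n ^ 2)) {ε : ℝ} (hε : 0 < ε) :
    ∀ᵐ ω ∂P, ∀ᶠ n in atTop, ∑ i ∈ Finset.range n, Z n i ω < ε := by
  -- the Chernoff parameter is `s * r n`, with `s` so small that `s * r n * (B / r n) ≤ 1`
  set s : ℝ := (|B| + 1)⁻¹ with hs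
  have hs0 : 0 < s := by positivity
  have key : ∀ n, 1 ≤ n → P.real {ω | ε ≤ ∑ i ∈ Finset.range n, Z n i ω} ≤
      Real.exp (s ^ 2 * C) * Real.exp (-(s * ε * r n)) := by
    intro n hn
    have hrn := hr n hn
    have ht : |s * r n| * (B / r n) ≤ 1 := by
      rw [abs_of_pos (by positivity), hs]
      have : (|B| + 1)⁻¹ * r n * (B / r n) = B / (|B| + 1) := by field_simp
      rw [this, div_le_one (by positivity)]
      linarith [le_abs_self B]
    have hm : mgf (∑ i ∈ Finset.range n, Z n i) P (s * r n) ≤ Real.exp (s ^ 2 * C) := by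
      rw [(hind n).mgf_sum (hZ n)]
      calc ∏ i ∈ Finset.range n, mgf (Z n i) P (s * r n)
          ≤ ∏ i ∈ Finset.range n, Real.exp ((s * r n) ^ 2 * (C / (n * r n ^ 2))) :=
            Finset.prod_le_prod (fun i _ => mgf_nonneg) fun i hi => by
              have hi := Finset.mem_range.1 hi
              exact mgf_le_exp_sq_mul (hZ n i) (hB n i hi) (hmean n i hi) (hvar n i hi) ht
        _ = Real.exp (s ^ 2 * C) := by
            rw [Finset.prod_const, Finset.card_range, ← Real.exp_nat_mul]
            congr 1
            have : (n : ℝ) ≠ 0 := by positivity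
            field_simp
    have hint : Integrable (fun ω => Real.exp (s * r n * (∑ i ∈ Finset.range n, Z n i) ω)) P := by
      refine .of_bound (C := Real.exp (s * r n * ∑ i ∈ Finset.range n, B / r n)) ?_
        (.of_forall fun ω => ?_)
      · simp only [Finset.sum_apply]
        exact (Real.measurable_exp.comp ((Finset.measurable_sum _ fun i _ =>
          hZ n i).const_mul _)).aestronglyMeasurable
      · rw [Real.norm_eq_abs, Real.abs_exp, Finset.sum_apply]
        gcongr with i hi
        exact (le_abs_self _).trans (hB n i (Finset.mem_range.1 hi) ω)
    have := measure_ge_le_exp_mul_mgf (μ := P) ε (by positivity : 0 ≤ s * r n) hint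
    simp only [Finset.sum_apply] at this
    refine this.trans ?_
    rw [mul_comm]
    gcongr
    linarith
  have hsm : ∑' n, P {ω | ε ≤ ∑ i ∈ Finset.range n, Z n i ω} ≠ ∞ := by
    have hS : Summable fun n => P.real {ω | ε ≤ ∑ i ∈ Finset.range n, Z n i ω} := by
      refine Summable.of_norm_bounded_eventually_nat
        ((hsum (s * ε) (by positivity)).mul_left (Real.exp (s ^ 2 * C))) ?_
      filter_upwards [eventually_ge_atTop 1] with n hn
      rw [Real.norm_eq_abs, abs_of_nonneg measureReal_nonneg]
      exact key n hn
    have := hS.tsum_ofReal_ne_top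
    simpa [ofReal_measureReal] using this
  filter_upwards [ae_eventually_notMem hsm] with ω hω
  filter_upwards [hω] with n hn
  simpa using hn

/-- The strong law for triangular arrays: a sum over the `n`-th row of `n` independent centred
variables that are bounded by `B / r n` and have variance at most `C / (n r_n²)` tends to zero, as
soon as the tails `exp (-s r_n)` are summable. -/
theorem ae_tendsto_sum_zero {r : ℕ → ℝ} (hr : ∀ n, 1 ≤ n → 0 < r n)
    (hsum : ∀ s > 0, Summable fun n => Real.exp (-(s * r n)))
    {Z : ℕ → ℕ → Ω → ℝ} (hZ : ∀ n i, Measurable (Z n i)) (hind : ∀ n, iIndepFun (Z n) P)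
    {B C : ℝ} (hB : ∀ n i, i < n → ∀ ω, |Z n i ω| ≤ B / r n)
    (hmean : ∀ n i, i < n → ∫ ω, Z n i ω ∂P = 0)
    (hvar : ∀ n i, i < n → ∫ ω, Z n i ω ^ 2 ∂P ≤ C / (n * r n ^ 2)) :
    ∀ᵐ ω ∂P, Tendsto (fun n => ∑ i ∈ Finset.range n, Z n i ω) atTop (𝓝 0) := by
  have h1 : ∀ᵐ ω ∂P, ∀ k : ℕ, ∀ᶠ n in atTop,
      ∑ i ∈ Finset.range n, Z n i ω < 1 / ((k : ℝ) + 1) :=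
    ae_all_iff.2 fun k => ae_eventually_sum_lt hr hsum hZ hind hB hmean hvar (by positivity)
  have h2 : ∀ᵐ ω ∂P, ∀ k : ℕ, ∀ᶠ n in atTop,
      ∑ i ∈ Finset.range n, -Z n i ω < 1 / ((k : ℝ) + 1) :=
    ae_all_iff.2 fun k => ae_eventually_sum_lt (Z := fun n i ω => -Z n i ω) hr hsum
      (fun n i => (hZ n i).neg) (fun n => (hind n).comp (fun _ x => -x) fun _ => measurable_neg)
      (B := B) (C := C) (fun n i hi ω => by simpa using hB n i hi ω)
      (fun n i hi => by rw [integral_neg, hmean n i hi, neg_zero])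
      (fun n i hi => by simpa using hvar n i hi) (by positivity)
  filter_upwards [h1, h2] with ω h1 h2
  rw [Metric.tendsto_nhds]
  intro ε hε
  obtain ⟨k, hk⟩ := exists_nat_one_div_lt hε
  filter_upwards [h1 k, h2 k] with n h1 h2
  rw [Finset.sum_neg_distrib] at h2
  rw [Real.dist_eq, sub_zero, abs_lt]
  constructor <;> linarith

end Chernoff

/-- Two independent sequences of independent variables pair up to a sequence of independent
pairs. -/
theorem iIndepFun_prodMk {Ω : Type*} [MeasurableSpace Ω] {P : Measure Ω} {β γ : Type*}
    [MeasurableSpace β] [MeasurableSpace γ]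
    {X : ℕ → Ω → β} {V : ℕ → Ω → γ} (hX : iIndepFun X P) (hV : iIndepFun V P)
    (hXm : ∀ i, Measurable (X i)) (hVm : ∀ i, Measurable (V i))
    (hXV : IndepFun (fun ω i => X i ω) (fun ω i => V i ω) P) :
    iIndepFun (fun i ω => (X i ω, V i ω)) P := by
  let π : ℕ → Set (Set Ω) := fun i =>
    {s | ∃ A B, MeasurableSet A ∧ MeasurableSet B ∧ s = X i ⁻¹' A ∩ V i ⁻¹' B}
  refine iIndepSets.iIndep (π := π) (fun i => ?_) (fun i => ?_) (fun i => ?_) ?_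
  · exact ((hXm i).prodMk (hVm i)).comap_le
  · rintro _ ⟨A, B, hA, hB, rfl⟩ _ ⟨A', B', hA', hB', rfl⟩ -
    refine ⟨A ∩ A', B ∩ B', hA.inter hA', hB.inter hB', ?_⟩
    ext ω; simp only [Set.mem_inter_iff, Set.mem_preimage]; tauto
  · rw [← generateFrom_prod, MeasurableSpace.comap_generateFrom]
    congr 1
    ext s
    constructor
    · rintro ⟨_, ⟨A, hA, B, hB, rfl⟩, rfl⟩
      exact ⟨A, B, hA, hB, rfl⟩
    · rintro ⟨A, B, hA, hB, rfl⟩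
      exact ⟨_, ⟨A, hA, B, hB, rfl⟩, rfl⟩
  · rw [iIndepSets_iff]
    intro s F hF
    choose! A B hA hB hFe using hF
    have e1 : (⋂ i ∈ s, F i) = (fun ω i => X i ω) ⁻¹' (⋂ i ∈ s, (fun x => x i) ⁻¹' A i) ∩
        (fun ω i => V i ω) ⁻¹' (⋂ i ∈ s, (fun x => x i) ⁻¹' B i) := by
      rw [Set.iInter₂_congr hFe]
      ext ω
      simp only [Set.mem_iInter, Set.mem_inter_iff, Set.mem_preimage]
      exact ⟨fun h => ⟨fun i hi => (h i hi).1, fun i hi => (h i hi).2⟩,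
        fun h i hi => ⟨h.1 i hi, h.2 i hi⟩⟩
    have hmA : MeasurableSet (⋂ i ∈ s, (fun x : ℕ → β => x i) ⁻¹' A i) :=
      s.measurableSet_biInter fun i hi => measurable_pi_apply i (hA i hi)
    have hmB : MeasurableSet (⋂ i ∈ s, (fun x : ℕ → γ => x i) ⁻¹' B i) :=
      s.measurableSet_biInter fun i hi => measurable_pi_apply i (hB i hi)
    rw [e1, hXV.measure_inter_preimage_eq_mul _ _ hmA hmB]
    simp only [Set.preimage_iInter]
    have hp1 := hX.measure_inter_preimage_eq_mul s (sets := A) hA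
    have hp2 := hV.measure_inter_preimage_eq_mul s (sets := B) hB
    have hp3 : ∀ i ∈ s, P (F i) = P (X i ⁻¹' A i) * P (V i ⁻¹' B i) := by
      intro i hi
      rw [hFe i hi]
      exact (hXV.comp (measurable_pi_apply i) (measurable_pi_apply i)).measure_inter_preimage_eq_mul
        _ _ (hA i hi) (hB i hi)
    rw [Finset.prod_congr rfl hp3, Finset.prod_mul_distrib, ← hp1, ← hp2]
    rfl

/-! ### The bandwidth and the effective rate -/

/-- The square root `n^{2/(d+4)}` of the effective sample size `n h^d`. -/
noncomputable def effectiveRate (d n : ℕ) : ℝ := (n : ℝ) ^ (2 / ((d : ℝ) + 4))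

theorem bandwidth_pos (d : ℕ) {n : ℕ} (hn : 1 ≤ n) : 0 < bandwidth d n :=
  Real.rpow_pos_of_pos (by exact_mod_cast hn) _

theorem bandwidth_le_bandwidth (d : ℕ) {m n : ℕ} (hm : 1 ≤ m) (hmn : m ≤ n) :
    bandwidth d n ≤ bandwidth d m :=
  Real.rpow_le_rpow_of_nonpos (by exact_mod_cast hm) (by exact_mod_cast hmn)
    (div_nonpos_of_nonpos_of_nonneg (by norm_num) (by positivity))

theorem tendsto_bandwidth (d : ℕ) : Tendsto (bandwidth d) atTop (𝓝 0) := by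
  have h : 0 < 1 / ((d : ℝ) + 4) := by positivity
  refine ((tendsto_rpow_neg_atTop h).comp tendsto_natCast_atTop_atTop).congr fun n => ?_
  simp only [Function.comp, bandwidth, neg_div]

theorem effectiveRate_pos (d : ℕ) {n : ℕ} (hn : 1 ≤ n) : 0 < effectiveRate d n :=
  Real.rpow_pos_of_pos (by exact_mod_cast hn) _

theorem one_le_effectiveRate (d : ℕ) {n : ℕ} (hn : 1 ≤ n) : 1 ≤ effectiveRate d n :=
  Real.one_le_rpow (by exact_mod_cast hn) (by positivity)

theorem effectiveRate_mono (d : ℕ) : Monotone (effectiveRate d) := fun m n h =>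
  Real.rpow_le_rpow (by positivity) (by exact_mod_cast h) (by positivity)

theorem tendsto_effectiveRate (d : ℕ) : Tendsto (effectiveRate d) atTop atTop :=
  (tendsto_rpow_atTop (by positivity)).comp tendsto_natCast_atTop_atTop

theorem natCast_mul_bandwidth_pow (d : ℕ) {n : ℕ} (hn : 1 ≤ n) :
    (n : ℝ) * bandwidth d n ^ d = effectiveRate d n ^ 2 := by
  have hn0 : (0 : ℝ) < n := by exact_mod_cast hn
  rw [bandwidth, effectiveRate, ← Real.rpow_mul_natCast hn0.le, ← Real.rpow_mul_natCast hn0.le]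
  nth_rewrite 1 [← Real.rpow_one (n : ℝ)]
  rw [← Real.rpow_add hn0]
  congr 1
  push_cast
  field_simp
  ring

theorem summable_exp_neg_mul_effectiveRate (d : ℕ) {s : ℝ} (hs : 0 < s) :
    Summable fun n => Real.exp (-(s * effectiveRate d n)) := by
  have h := (isLittleO_exp_neg_mul_rpow_atTop hs (-((d : ℝ) + 4))).comp_tendsto
    (tendsto_effectiveRate d)
  have h2 : Summable fun n : ℕ => (n : ℝ) ^ (-2 : ℝ) :=
    Real.summable_nat_rpow.2 (by norm_num)
  refine summable_of_isBigO_nat h2 ?_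
  refine (h.isBigO.congr_left fun n => ?_).congr_right fun n => ?_
  · simp [Function.comp]
  · simp only [Function.comp, effectiveRate]
    rw [← Real.rpow_mul (by positivity)]
    congr 1
    field_simp

/-! ### The tangent cone of a convex set -/

section Cone

variable {d : ℕ}

/-- The radial cone of `U` at `u`: the directions in which some positive step from `u` ends in
`U`. -/
def radialCone (U : Set (EuclideanSpace ℝ (Fin d))) (u : EuclideanSpace ℝ (Fin d)) :
    Set (EuclideanSpace ℝ (Fin d)) :=
  {z | ∃ t : ℝ, 0 < t ∧ u + t • z ∈ U}

variable {U : Set (EuclideanSpace ℝ (Fin d))} {u : EuclideanSpace ℝ (Fin d)}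

theorem add_smul_mem_of_le (hU : Convex ℝ U) (hu : u ∈ U) {z : EuclideanSpace ℝ (Fin d)} {s t : ℝ}
    (ht : 0 < t) (hz : u + t • z ∈ U) (hs : 0 ≤ s) (hst : s ≤ t) : u + s • z ∈ U := by
  have := hU.add_smul_mem hu hz (t := s / t) ⟨by positivity, (div_le_one ht).2 hst⟩
  rwa [smul_smul, div_mul_cancel₀ _ ht.ne'] at this

theorem smul_mem_radialCone {z : EuclideanSpace ℝ (Fin d)} (hz : z ∈ radialCone U u) {c : ℝ}
    (hc : 0 < c) : c • z ∈ radialCone U u := by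
  obtain ⟨t, ht, hz⟩ := hz
  exact ⟨t / c, by positivity, by rwa [smul_smul, div_mul_cancel₀ _ hc.ne']⟩

theorem convex_radialCone (hU : Convex ℝ U) (hu : u ∈ U) : Convex ℝ (radialCone U u) := by
  rintro z₁ ⟨t₁, ht₁, h₁⟩ z₂ ⟨t₂, ht₂, h₂⟩ a b ha hb hab
  have hm : 0 < min t₁ t₂ := lt_min ht₁ ht₂
  refine ⟨min t₁ t₂, hm, ?_⟩
  convert hU (add_smul_mem_of_le hU hu ht₁ h₁ hm.le (min_le_left _ _))
    (add_smul_mem_of_le hU hu ht₂ h₂ hm.le (min_le_right _ _)) ha hb hab using 1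
  have : u = (a + b) • u := by rw [hab, one_smul]
  nth_rewrite 1 [this]
  module

theorem radialCone_subset_tangentConeAt (hU : Convex ℝ U) (hu : u ∈ U) :
    radialCone U u ⊆ tangentConeAt ℝ≥0 U u := by
  rintro z ⟨t, ht, hz⟩
  have hlim : Tendsto (fun n : ℕ => t * (1 / ((n : ℝ) + 1))) atTop (𝓝 0) := by
    simpa using tendsto_one_div_add_atTop_nhds_zero_nat.const_mul t
  refine mem_tangentConeAt_of_seq atTop (fun n : ℕ => Real.toNNReal (((n : ℝ) + 1) / t))
    (fun n : ℕ => (t * (1 / ((n : ℝ) + 1))) • z) ?_ (.of_forall fun n => ?_) ?_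
  · simpa using hlim.smul_const z
  · refine add_smul_mem_of_le hU hu ht hz (by positivity) (mul_le_of_le_one_right ht.le ?_)
    rw [div_le_one (by positivity)]
    linarith [n.cast_nonneg (α := ℝ)]
  · refine tendsto_const_nhds.congr fun n => ?_
    rw [NNReal.smul_def, Real.coe_toNNReal _ (by positivity), smul_smul]
    have : ((n : ℝ) + 1) / t * (t * (1 / ((n : ℝ) + 1))) = 1 := by field_simp
    rw [this, one_smul]

theorem tangentConeAt_subset_closure_radialCone (hu : u ∈ U) :
    tangentConeAt ℝ≥0 U u ⊆ closure (radialCone U u) := by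
  intro y hy
  obtain ⟨α, l, hl, c, v, -, hv, hcv⟩ := exists_fun_of_mem_tangentConeAt hy
  refine mem_closure_of_tendsto hcv ?_
  filter_upwards [hv] with n hn
  rcases eq_or_ne (c n) 0 with h0 | h0
  · rw [h0, zero_smul]
    exact ⟨1, one_pos, by simpa using hu⟩
  · rw [NNReal.smul_def]
    exact smul_mem_radialCone ⟨1, one_pos, by simpa using hn⟩
      (NNReal.coe_pos.2 (pos_iff_ne_zero.2 h0))

/-- For a convex set the tangent cone is the radial cone up to a null set: it lies between the
radial cone and its closure, and the frontier of a convex set is null. -/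
theorem tangentConeAt_ae_eq_radialCone (hU : Convex ℝ U) (hu : u ∈ U) :
    tangentConeAt ℝ≥0 U u =ᵐ[volume] radialCone U u := by
  refine EventuallyLE.antisymm ?_ (radialCone_subset_tangentConeAt hU hu).eventuallyLE
  refine ae_le_set.2 (measure_mono_null ?_ ((convex_radialCone hU hu).addHaar_frontier volume))
  rintro z ⟨hz, hz'⟩
  exact ⟨tangentConeAt_subset_closure_radialCone hu hz, fun h => hz' (interior_subset h)⟩

end Cone

/-! ### The kernel and its mass on the tangent cone -/

section Kernel

variable {d : ℕ} {φ : ℝ → ℝ}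

theorem IsKernel.eq_zero (hφ : IsKernel φ) {t : ℝ} (ht : 1 ≤ t) : φ t = 0 := by
  obtain ⟨η, -, -, -, h⟩ := hφ.support
  exact h t (ht.trans (le_abs_self t))

theorem measurable_scaledKernel (hφ : IsKernel φ) (h : ℝ) :
    Measurable (scaledKernel (d := d) φ h) :=
  (hφ.measurable.comp (measurable_norm.div_const h)).const_mul _

theorem scaledKernel_nonneg (hφ : IsKernel φ) {h : ℝ} (hh : 0 ≤ h)
    (x : EuclideanSpace ℝ (Fin d)) : 0 ≤ scaledKernel φ h x :=
  mul_nonneg (by positivity) (hφ.nonneg _)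

theorem scaledKernel_eq_zero (hφ : IsKernel φ) {h : ℝ} (hh : 0 < h)
    {x : EuclideanSpace ℝ (Fin d)} (hx : h ≤ ‖x‖) : scaledKernel φ h x = 0 := by
  rw [scaledKernel, hφ.eq_zero ((one_le_div hh).2 hx), mul_zero]

theorem scaledKernel_le {M : ℝ} (hM : ∀ t, φ t ≤ M) {h : ℝ} (hh : 0 ≤ h)
    (x : EuclideanSpace ℝ (Fin d)) : scaledKernel φ h x ≤ (h ^ d)⁻¹ * M :=
  mul_le_mul_of_nonneg_left (hM _) (by positivity)

theorem integrable_kernel_norm (hφ : IsKernel φ) :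
    Integrable (fun z : EuclideanSpace ℝ (Fin d) => φ ‖z‖) := by
  obtain ⟨M, hM⟩ := hφ.bounded
  have hs : Function.support (fun z : EuclideanSpace ℝ (Fin d) => φ ‖z‖) ⊆
      Metric.ball 0 1 := fun z hz => by
    rw [mem_ball_zero_iff]
    by_contra h
    exact hz (hφ.eq_zero (not_lt.1 h))
  rw [← integrableOn_iff_integrable_of_support_subset hs]
  refine Measure.integrableOn_of_bounded (M := M) measure_ball_lt_top.ne
    (hφ.measurable.comp measurable_norm).aestronglyMeasurable (.of_forall fun z => ?_)
  rw [Real.norm_of_nonneg (hφ.nonneg _)]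
  exact hM _

theorem kernelMass_eq (φ : ℝ → ℝ) {U : Set (EuclideanSpace ℝ (Fin d))}
    {u : EuclideanSpace ℝ (Fin d)} (hU : Convex ℝ U) (hu : u ∈ U) :
    kernelMass φ U u = ∫ z in radialCone U u, φ ‖z‖ := by
  rw [kernelMass, setIntegral_congr_set (tangentConeAt_ae_eq_radialCone hU hu)]
  simp [scaledKernel]

/-- The mass is positive because the radial cone contains a scaled copy of `U - u` inside the ball
on which the kernel is positive. -/
theorem kernelMass_pos (hφ : IsKernel φ) {U : Set (EuclideanSpace ℝ (Fin d))}
    {u : EuclideanSpace ℝ (Fin d)} (hU : Convex ℝ U) (hUb : Bornology.IsBounded U) (hu : u ∈ U)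
    (hvol : volume U ≠ 0) : 0 < kernelMass φ U u := by
  rw [kernelMass_eq φ hU hu, setIntegral_pos_iff_support_of_nonneg_ae
    (.of_forall fun z => hφ.nonneg _) (integrable_kernel_norm hφ).integrableOn]
  obtain ⟨η, hη0, -, hη, -⟩ := hφ.support
  obtain ⟨R, hR⟩ := hUb.subset_closedBall u
  have hR0 : 0 ≤ R := dist_nonneg.trans (Metric.mem_closedBall.1 (hR hu))
  have hs : 0 < η / (R + 1) := by positivity
  have hsub : (η / (R + 1)) • ((fun z => u + z) ⁻¹' U) ⊆
      Function.support (fun z : EuclideanSpace ℝ (Fin d) => φ ‖z‖) ∩ radialCone U u := by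
    rintro _ ⟨z, hz, rfl⟩
    refine ⟨(hη _ ?_).ne', smul_mem_radialCone ⟨1, one_pos, by simpa using hz⟩ hs⟩
    have hzR : ‖z‖ ≤ R := by simpa [Metric.mem_closedBall, dist_eq_norm] using hR hz
    simp only [norm_smul, Real.norm_of_nonneg hs.le, abs_mul, abs_norm, abs_of_pos hs]
    rw [div_mul_eq_mul_div, div_le_iff₀ (by positivity)]
    nlinarith
  refine lt_of_lt_of_le ?_ (measure_mono hsub)
  rw [Measure.addHaar_smul, measure_preimage_add]
  refine ENNReal.mul_pos ?_ hvol
  simp only [ne_eq, ENNReal.ofReal_eq_zero, not_le]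
  positivity

end Kernel

/-! ### Moments of the kernel weights -/

section Design

variable {d : ℕ} {φ : ℝ → ℝ} {U : Set (EuclideanSpace ℝ (Fin d))}
  {u : EuclideanSpace ℝ (Fin d)} {f : EuclideanSpace ℝ (Fin d) → ℝ}
  {μ : Measure (EuclideanSpace ℝ (Fin d))}

/-- The substitution `x = u + h z` in the mean of a kernel weight. -/
theorem integral_scaledKernel_eq (hU : IsCompact U) (hf : ContinuousOn f U)
    (hf0 : ∀ x ∈ U, 0 ≤ f x)
    (hμ : μ = (volume.restrict U).withDensity fun x => ENNReal.ofReal (f x))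
    {h : ℝ} (hh : 0 < h) :
    ∫ x, scaledKernel φ h (x - u) ∂μ = ∫ z, U.indicator f (u + h • z) * φ ‖z‖ := by
  have hfm : AEMeasurable f (volume.restrict U) := hf.aemeasurable hU.measurableSet
  have hT := Measure.integral_comp_smul volume
    (fun y : EuclideanSpace ℝ (Fin d) => U.indicator f (u + y) * φ (‖y‖ / h)) h
  have hT' : ∀ z : EuclideanSpace ℝ (Fin d), ‖h • z‖ / h = ‖z‖ := fun z => by
    rw [norm_smul, Real.norm_of_nonneg hh.le]; field_simp
  simp only [hT', finrank_euclideanSpace_fin] at hT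
  rw [hT, abs_of_pos (by positivity), smul_eq_mul, ← integral_const_mul, hμ,
    integral_withDensity_eq_integral_toReal_smul₀ hfm.ennreal_ofReal (by simp),
    ← integral_indicator hU.measurableSet,
    ← integral_add_left_eq_self _ u]
  refine integral_congr_ae (.of_forall fun y => ?_)
  by_cases hy : u + y ∈ U
  · simp only [Set.indicator_of_mem hy, smul_eq_mul, ENNReal.toReal_ofReal (hf0 _ hy),
      scaledKernel, add_sub_cancel_left]
    ring
  · simp [Set.indicator_of_notMem hy]

/-- As `h → 0` the integrand `1_U(u + h z) f(u + h z) φ(‖z‖)` tends to `f(u) φ(‖z‖)` on the radial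
cone and is zero off it. -/
theorem tendsto_integral_scaledKernel (hφ : IsKernel φ) (hUconv : Convex ℝ U) (hU : IsCompact U)
    (hu : u ∈ U) (hf : ContinuousOn f U) (hf0 : ∀ x ∈ U, 0 ≤ f x)
    (hμ : μ = (volume.restrict U).withDensity fun x => ENNReal.ofReal (f x))
    {h : ℕ → ℝ} (hh : ∀ᶠ n in atTop, 0 < h n) (hh0 : Tendsto h atTop (𝓝 0)) :
    Tendsto (fun n => ∫ x, scaledKernel φ (h n) (x - u) ∂μ) atTop
      (𝓝 (kernelMass φ U u * f u)) := by
  obtain ⟨F, hF⟩ := hU.exists_bound_of_continuousOn hf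
  have hF0 : 0 ≤ F := (norm_nonneg _).trans (hF u hu)
  have hgm : Measurable (U.indicator f) := by
    classical
    rw [← Set.piecewise_eq_indicator]
    exact ContinuousOn.measurable_piecewise hf continuousOn_const hU.measurableSet
  have hlim : kernelMass φ U u * f u =
      ∫ z, (radialCone U u).indicator (fun z => f u * φ ‖z‖) z := by
    rw [integral_indicator₀ ((convex_radialCone hUconv hu).nullMeasurableSet volume),
      integral_const_mul, ← kernelMass_eq φ hUconv hu, mul_comm]
  have hmain : Tendsto (fun n => ∫ z, U.indicator f (u + h n • z) * φ ‖z‖) atTop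
      (𝓝 (kernelMass φ U u * f u)) := by
    rw [hlim]
    refine tendsto_integral_of_dominated_convergence (fun z => F * φ ‖z‖) (fun n => ?_)
      ((integrable_kernel_norm hφ).const_mul F) (fun n => .of_forall fun z => ?_)
      (.of_forall fun z => ?_)
    · exact ((hgm.comp ((measurable_id.const_smul (h n)).const_add u)).mul
        (hφ.measurable.comp measurable_norm)).aestronglyMeasurable
    · rw [norm_mul, Real.norm_of_nonneg (hφ.nonneg _)]
      refine mul_le_mul_of_nonneg_right ?_ (hφ.nonneg _)
      by_cases hz : u + h n • z ∈ U
      · rw [Set.indicator_of_mem hz]; exact hF _ hz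
      · rw [Set.indicator_of_notMem hz, norm_zero]; exact hF0
    · by_cases hz : z ∈ radialCone U u
      · rw [Set.indicator_of_mem hz]
        refine Tendsto.mul_const _ ?_
        obtain ⟨t, ht, hzt⟩ := hz
        have hin : ∀ᶠ n in atTop, u + h n • z ∈ U := by
          filter_upwards [hh, hh0.eventually (gt_mem_nhds ht)] with n h1 h2
          exact add_smul_mem_of_le hUconv hu ht hzt h1.le h2.le
        have hto : Tendsto (fun n => u + h n • z) atTop (𝓝[U] u) := by
          refine tendsto_nhdsWithin_iff.2 ⟨?_, hin⟩
          simpa using (hh0.smul_const z).const_add u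
        refine ((hf u hu).tendsto.comp hto).congr' ?_
        filter_upwards [hin] with n hn
        rw [Set.indicator_of_mem hn, Function.comp]
      · rw [Set.indicator_of_notMem hz]
        refine tendsto_const_nhds.congr' ?_
        filter_upwards [hh] with n hn
        rw [Set.indicator_of_notMem (fun hm => hz ⟨h n, hn, hm⟩), zero_mul]
  refine hmain.congr' ?_
  filter_upwards [hh] with n hn
  rw [integral_scaledKernel_eq hU hf hf0 hμ hn]

/-- The density is bounded on `U`, so the design charges a ball of radius `h` at most `C h^d`. -/
theorem exists_measure_ball_le (hU : IsCompact U) (hf : ContinuousOn f U)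
    (hμ : μ = (volume.restrict U).withDensity fun x => ENNReal.ofReal (f x))
    (u : EuclideanSpace ℝ (Fin d)) :
    ∃ C : ℝ, 0 ≤ C ∧ ∀ h > 0, μ (Metric.ball u h) ≤ ENNReal.ofReal (C * h ^ d) := by
  obtain ⟨F, hF⟩ := hU.exists_bound_of_continuousOn hf
  refine ⟨|F| * (volume (Metric.ball (0 : EuclideanSpace ℝ (Fin d)) 1)).toReal, by positivity,
    fun h hh => ?_⟩
  rw [hμ, withDensity_apply _ Metric.isOpen_ball.measurableSet,
    Measure.restrict_restrict Metric.isOpen_ball.measurableSet]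
  calc ∫⁻ x in Metric.ball u h ∩ U, ENNReal.ofReal (f x)
      ≤ ∫⁻ x in Metric.ball u h ∩ U, ENNReal.ofReal |F| := by
        refine setLIntegral_mono' (Metric.isOpen_ball.measurableSet.inter hU.measurableSet)
          fun x hx => ENNReal.ofReal_le_ofReal ?_
        exact (le_abs_self _).trans ((hF x hx.2).trans (le_abs_self _))
    _ ≤ ENNReal.ofReal |F| * volume (Metric.ball u h) := by
        rw [setLIntegral_const]
        gcongr
        exact Set.inter_subset_left
    _ = _ := by
        rw [Measure.addHaar_ball_of_pos volume u hh, finrank_euclideanSpace_fin,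
          ENNReal.ofReal_mul (by positivity), ENNReal.ofReal_mul (by positivity),
          ENNReal.ofReal_toReal measure_ball_lt_top.ne]
        ring

theorem integral_sq_scaledKernel_le (hφ : IsKernel φ) [IsFiniteMeasure μ] {M C h : ℝ}
    (hM : ∀ t, φ t ≤ M)
    (hC0 : 0 ≤ C) (hh : 0 < h) (hC : μ (Metric.ball u h) ≤ ENNReal.ofReal (C * h ^ d)) :
    ∫ x, scaledKernel φ h (x - u) ^ 2 ∂μ ≤ M ^ 2 * C / h ^ d := by
  have hC' : μ.real (Metric.ball u h) ≤ C * h ^ d :=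
    ENNReal.toReal_le_of_le_ofReal (by positivity) hC
  calc ∫ x, scaledKernel φ h (x - u) ^ 2 ∂μ
      ≤ ∫ x, (Metric.ball u h).indicator (fun _ => ((h ^ d)⁻¹ * M) ^ 2) x ∂μ := by
        refine integral_mono_of_nonneg (.of_forall fun x => sq_nonneg _)
          ((integrable_const _).indicator Metric.isOpen_ball.measurableSet)
          (.of_forall fun x => ?_)
        by_cases hx : x ∈ Metric.ball u h
        · simp only [Set.indicator_of_mem hx]
          exact pow_le_pow_left₀ (scaledKernel_nonneg hφ hh.le _) (scaledKernel_le hM hh.le _) 2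
        · simp only [Set.indicator_of_notMem hx]
          rw [Metric.mem_ball, dist_eq_norm, not_lt] at hx
          rw [scaledKernel_eq_zero hφ hh hx]
          simp
    _ = ((h ^ d)⁻¹ * M) ^ 2 * μ.real (Metric.ball u h) := by
        rw [integral_indicator Metric.isOpen_ball.measurableSet, setIntegral_const, smul_eq_mul,
          mul_comm]
    _ ≤ ((h ^ d)⁻¹ * M) ^ 2 * (C * h ^ d) := by gcongr
    _ = M ^ 2 * C / h ^ d := by field_simp

end Design

/-! ### The density estimate -/

section LawOfLargeNumbers

variable {d : ℕ} {Ω : Type*} [MeasurableSpace Ω] {P : Measure Ω}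
  {φ : ℝ → ℝ} {u : EuclideanSpace ℝ (Fin d)} {μ : Measure (EuclideanSpace ℝ (Fin d))}
  {X : ℕ → Ω → EuclideanSpace ℝ (Fin d)} {C : ℝ}

theorem integral_sub_integral_sq_le [IsProbabilityMeasure P] {Y : Ω → ℝ} (hY : Measurable Y) :
    ∫ ω, (Y ω - ∫ ω', Y ω' ∂P) ^ 2 ∂P ≤ ∫ ω, Y ω ^ 2 ∂P := by
  rw [← variance_eq_integral hY.aemeasurable]
  exact variance_le_expectation_sq hY.aestronglyMeasurable

theorem inv_mul_scaledKernel_le {M : ℝ} (hM : ∀ t, φ t ≤ M) {n : ℕ} (hn : 1 ≤ n)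
    (x : EuclideanSpace ℝ (Fin d)) :
    (n : ℝ)⁻¹ * scaledKernel φ (bandwidth d n) x ≤ M / effectiveRate d n ^ 2 := by
  rw [← natCast_mul_bandwidth_pow d hn]
  calc (n : ℝ)⁻¹ * scaledKernel φ (bandwidth d n) x
      ≤ (n : ℝ)⁻¹ * ((bandwidth d n ^ d)⁻¹ * M) := by
        gcongr
        exact scaledKernel_le hM (bandwidth_pos d hn).le x
    _ = M / (n * bandwidth d n ^ d) := by
        rw [div_eq_mul_inv, mul_inv]; ring

theorem integral_sq_inv_mul_scaledKernel_le (hφ : IsKernel φ) [IsFiniteMeasure μ] {M : ℝ}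
    (hM : ∀ t, φ t ≤ M) (hC0 : 0 ≤ C)
    (hC : ∀ h > 0, μ (Metric.ball u h) ≤ ENNReal.ofReal (C * h ^ d)) {n : ℕ} (hn : 1 ≤ n) :
    ∫ x, ((n : ℝ)⁻¹ * scaledKernel φ (bandwidth d n) (x - u)) ^ 2 ∂μ ≤
      M ^ 2 * C / (n * effectiveRate d n ^ 2) := by
  have hh := bandwidth_pos d hn
  have hn0 : (0 : ℝ) < n := by exact_mod_cast hn
  simp only [mul_pow]
  rw [integral_const_mul, ← natCast_mul_bandwidth_pow d hn]
  calc ((n : ℝ)⁻¹) ^ 2 * ∫ x, scaledKernel φ (bandwidth d n) (x - u) ^ 2 ∂μ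
      ≤ ((n : ℝ)⁻¹) ^ 2 * (M ^ 2 * C / bandwidth d n ^ d) := by
        gcongr
        exact integral_sq_scaledKernel_le hφ hM hC0 hh (hC _ hh)
    _ = _ := by field_simp

theorem ae_tendsto_density_estimate [IsProbabilityMeasure P] (hφ : IsKernel φ)
    (hXm : ∀ i, Measurable (X i)) (hXind : iIndepFun X P) (hXlaw : ∀ i, P.map (X i) = μ)
    (hC0 : 0 ≤ C) (hC : ∀ h > 0, μ (Metric.ball u h) ≤ ENNReal.ofReal (C * h ^ d)) {g : ℝ}
    (hg : Tendsto (fun n => ∫ x, scaledKernel φ (bandwidth d n) (x - u) ∂μ) atTop (𝓝 g)) :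
    ∀ᵐ ω ∂P, Tendsto (fun n : ℕ => (n : ℝ)⁻¹ * ∑ i ∈ Finset.range n,
      scaledKernel φ (bandwidth d n) (X i ω - u)) atTop (𝓝 g) := by
  have hμ : IsProbabilityMeasure μ :=
    hXlaw 0 ▸ Measure.isProbabilityMeasure_map (hXm 0).aemeasurable
  obtain ⟨M, hM⟩ := hφ.bounded
  have hM0 : 0 ≤ M := (hφ.nonneg 0).trans (hM 0)
  let k : ℕ → EuclideanSpace ℝ (Fin d) → ℝ := fun n x =>
    (n : ℝ)⁻¹ * scaledKernel φ (bandwidth d n) (x - u)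
  have hk : ∀ n, Measurable (k n) := fun n =>
    ((measurable_scaledKernel hφ _).comp (measurable_id.sub_const u)).const_mul _
  have hk0 : ∀ n x, 1 ≤ n → 0 ≤ k n x := fun n x hn =>
    mul_nonneg (by positivity) (scaledKernel_nonneg hφ (bandwidth_pos d hn).le _)
  have hkM : ∀ n x, 1 ≤ n → k n x ≤ M / effectiveRate d n := fun n x hn => by
    refine (inv_mul_scaledKernel_le hM hn _).trans ?_
    have := one_le_effectiveRate d hn
    gcongr
    nlinarith
  have hint : ∀ n, 1 ≤ n → Integrable (k n) μ := fun n hn =>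
    .of_bound (hk n).aestronglyMeasurable _
      (.of_forall fun x => (Real.norm_of_nonneg (hk0 n x hn)).trans_le (hkM n x hn))
  have hmap : ∀ n i, ∫ ω, k n (X i ω) ∂P = ∫ x, k n x ∂μ := fun n i => by
    rw [← hXlaw i, integral_map (hXm i).aemeasurable (hk n).aestronglyMeasurable]
  have hZ := ae_tendsto_sum_zero (P := P) (r := effectiveRate d)
    (fun n hn => effectiveRate_pos d hn) (fun s hs => summable_exp_neg_mul_effectiveRate d hs)
    (Z := fun n i ω => k n (X i ω) - ∫ x, k n x ∂μ)
    (fun n i => ((hk n).comp (hXm i)).sub_const _)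
    (fun n => hXind.comp (fun _ x => k n x - ∫ x, k n x ∂μ) fun _ => (hk n).sub_const _)
    (B := M) (C := M ^ 2 * C) (fun n i hi ω => ?_) (fun n i hi => ?_) (fun n i hi => ?_)
  · filter_upwards [hZ] with ω hω
    have := hω.add hg
    rw [zero_add] at this
    refine this.congr' ?_
    filter_upwards [eventually_ge_atTop 1] with n hn
    have hn0 : (n : ℝ) ≠ 0 := by positivity
    rw [Finset.sum_sub_distrib, Finset.sum_const, Finset.card_range, nsmul_eq_mul]
    simp only [k]
    rw [integral_const_mul, mul_inv_cancel_left₀ hn0, sub_add_cancel, Finset.mul_sum]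
  · have hn : 1 ≤ n := by omega
    have h1 : ∫ x, k n x ∂μ ≤ M / effectiveRate d n := by
      calc ∫ x, k n x ∂μ ≤ ∫ x, M / effectiveRate d n ∂μ :=
            integral_mono (hint n hn) (integrable_const _) fun x => hkM n x hn
        _ = _ := by simp
    have h0 : 0 ≤ ∫ x, k n x ∂μ := integral_nonneg fun x => hk0 n x hn
    have := hk0 n (X i ω) hn
    have := hkM n (X i ω) hn
    rw [abs_le]
    constructor <;> linarith
  · have hn : 1 ≤ n := by omega
    have hmapint : Integrable (k n) (P.map (X i)) := by rw [hXlaw i]; exact hint n hn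
    have hi' : Integrable (fun ω => k n (X i ω)) P := hmapint.comp_measurable (hXm i)
    rw [integral_sub hi' (integrable_const _), hmap]
    simp
  · have hn : 1 ≤ n := by omega
    rw [← hmap n i]
    refine (integral_sub_integral_sq_le ((hk n).comp (hXm i))).trans ?_
    refine le_trans (le_of_eq ?_) (integral_sq_inv_mul_scaledKernel_le hφ hM hC0 hC hn)
    rw [← hXlaw i, integral_map (hXm i).aemeasurable ((hk n).pow_const 2).aestronglyMeasurable]
    rfl

/-- A weight vanishes unless `‖x i - u‖ < h`, so the weighted distances are at most `h` times the
total weight. -/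
theorem tendsto_sum_scaledKernel_mul_norm (hφ : IsKernel φ) {x : ℕ → EuclideanSpace ℝ (Fin d)}
    {g : ℝ} (hg : Tendsto (fun n : ℕ => (n : ℝ)⁻¹ * ∑ i ∈ Finset.range n,
      scaledKernel φ (bandwidth d n) (x i - u)) atTop (𝓝 g)) :
    Tendsto (fun n : ℕ => (n : ℝ)⁻¹ * ∑ i ∈ Finset.range n,
      scaledKernel φ (bandwidth d n) (x i - u) * ‖x i - u‖) atTop (𝓝 0) := by
  have hlim := (tendsto_bandwidth d).mul hg
  rw [zero_mul] at hlim
  refine tendsto_of_tendsto_of_tendsto_of_le_of_le' tendsto_const_nhds hlim ?_ ?_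
  · filter_upwards [eventually_ge_atTop 1] with n hn
    exact mul_nonneg (by positivity) (Finset.sum_nonneg fun i _ =>
      mul_nonneg (scaledKernel_nonneg hφ (bandwidth_pos d hn).le _) (norm_nonneg _))
  · filter_upwards [eventually_ge_atTop 1] with n hn
    have hh := bandwidth_pos d hn
    rw [mul_left_comm]
    refine mul_le_mul_of_nonneg_left ?_ (by positivity)
    rw [Finset.mul_sum]
    refine Finset.sum_le_sum fun i _ => ?_
    rw [mul_comm]
    by_cases h : bandwidth d n ≤ ‖x i - u‖
    · simp [scaledKernel_eq_zero hφ hh h]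
    · exact mul_le_mul_of_nonneg_right (not_le.1 h).le (scaledKernel_nonneg hφ hh.le _)

/-! ### The noise average -/

/-- With `a = 4/(d+4) ≤ 1` this reads `a k^{a-1} ≤ k^a - (k-1)^a`, Bernoulli's inequality for
`(1 - 1/k)^a`. -/
theorem mul_bandwidth_pow_le_sub (d k : ℕ) :
    4 / ((d : ℝ) + 4) * bandwidth d (k + 1) ^ d ≤
      effectiveRate d (k + 1) ^ 2 - effectiveRate d k ^ 2 := by
  set a : ℝ := 4 / ((d : ℝ) + 4) with ha
  have hd : (0 : ℝ) ≤ d := d.cast_nonneg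
  have ha0 : 0 ≤ a := by positivity
  have ha1 : a ≤ 1 := by rw [ha, div_le_one (by positivity)]; linarith
  have hr : ∀ n, effectiveRate d n ^ 2 = (n : ℝ) ^ a := fun n => by
    rw [effectiveRate, ← Real.rpow_mul_natCast n.cast_nonneg, ha]
    congr 1
    push_cast
    ring
  have hb := natCast_mul_bandwidth_pow d (n := k + 1) (by omega)
  have hk : (0 : ℝ) < (k : ℝ) + 1 := by positivity
  rw [hr] at hb ⊢
  rw [hr]
  push_cast at hb ⊢
  have hq : -1 ≤ -(1 / ((k : ℝ) + 1)) := by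
    rw [neg_le_neg_iff, div_le_one hk]; linarith [k.cast_nonneg (α := ℝ)]
  have hB := rpow_one_add_le_one_add_mul_self hq ha0 ha1
  have hkk : (k : ℝ) ^ a = ((k : ℝ) + 1) ^ a * (1 + -(1 / ((k : ℝ) + 1))) ^ a := by
    rw [← Real.mul_rpow hk.le (by linarith)]
    congr 1
    field_simp
    ring
  rw [hkk]
  have h2 := mul_le_mul_of_nonneg_left hB (Real.rpow_nonneg hk.le a)
  have h3 : ((k : ℝ) + 1) ^ a * (1 + a * -(1 / ((k : ℝ) + 1))) =
      ((k : ℝ) + 1) ^ a - a * bandwidth d (k + 1) ^ d := by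
    rw [← hb]; field_simp; ring
  linarith

/-- The sum telescopes by `mul_bandwidth_pow_le_sub`, up to the last index with `r_k² ≤ y`. -/
theorem sum_bandwidth_pow_le (d : ℕ) {y : ℝ} (hy : 0 ≤ y) (N : ℕ) :
    ∑ k ∈ Finset.range N, (if effectiveRate d (k + 1) ^ 2 ≤ y then bandwidth d (k + 1) ^ d else 0) ≤
      ((d : ℝ) + 4) / 4 * y := by
  have key : 4 / ((d : ℝ) + 4) * ∑ k ∈ Finset.range N,
      (if effectiveRate d (k + 1) ^ 2 ≤ y then bandwidth d (k + 1) ^ d else 0) ≤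
      min (effectiveRate d N ^ 2) y := by
    induction N with
    | zero => simpa using ⟨sq_nonneg _, hy⟩
    | succ N ih =>
      rw [Finset.sum_range_succ, mul_add]
      have hN := mul_bandwidth_pow_le_sub d N
      have h0 : 0 ≤ bandwidth d (N + 1) ^ d := by
        have := bandwidth_pos d (n := N + 1) (by omega); positivity
      have h4 : 0 ≤ 4 / ((d : ℝ) + 4) := by positivity
      have hmono : effectiveRate d N ^ 2 ≤ effectiveRate d (N + 1) ^ 2 := by nlinarith
      split_ifs with h
      · rw [min_eq_left h]
        linarith [ih.trans (min_le_left _ _)]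
      · rw [mul_zero, add_zero]
        exact ih.trans (min_le_min_right _ hmono)
  have := key.trans (min_le_right _ _)
  rw [div_mul_eq_mul_div, div_le_iff₀ (by positivity)] at this
  linarith

/-- Almost surely, only finitely many noise variables exceed the level `r_{i+1}` while their
design point is within `h_{i+1}` of `u`. By independence the `i`-th event has probability at most
`C h_{i+1}^d P(V² ≥ r_{i+1}²)`, and these sum to at most a multiple of `E V²`. -/
theorem ae_eventually_abs_lt_of_near
    (hXm : ∀ i, Measurable (X i)) (hXlaw : ∀ i, P.map (X i) = μ)
    (hC0 : 0 ≤ C) (hC : ∀ h > 0, μ (Metric.ball u h) ≤ ENNReal.ofReal (C * h ^ d))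
    {V : ℕ → Ω → ℝ} (hVm : ∀ i, Measurable (V i))
    (hVid : ∀ i, IdentDistrib (V i) (V 0) P P) (hV2 : MemLp (V 0) 2 P)
    (hXV : ∀ i, IndepFun (X i) (V i) P) :
    ∀ᵐ ω ∂P, ∀ᶠ i in atTop, ‖X i ω - u‖ < bandwidth d (i + 1) →
      |V i ω| < effectiveRate d (i + 1) := by
  let A : ℕ → Set ℝ := fun i => {v | effectiveRate d (i + 1) ^ 2 ≤ v ^ 2}
  have hA : ∀ i, MeasurableSet (A i) := fun i =>
    measurableSet_le measurable_const (measurable_id.pow_const 2)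
  have hb : ∀ i, MeasurableSet (Metric.ball u (bandwidth d (i + 1))) := fun i =>
    Metric.isOpen_ball.measurableSet
  have hP : ∀ i, P (X i ⁻¹' Metric.ball u (bandwidth d (i + 1)) ∩ V i ⁻¹' A i) ≤
      ∫⁻ ω, ENNReal.ofReal C * ENNReal.ofReal
        (if effectiveRate d (i + 1) ^ 2 ≤ V 0 ω ^ 2 then bandwidth d (i + 1) ^ d else 0) ∂P := by
    intro i
    have hh := bandwidth_pos d (n := i + 1) (by omega)
    have e : ∀ ω, ENNReal.ofReal C * ENNReal.ofReal
        (if effectiveRate d (i + 1) ^ 2 ≤ V 0 ω ^ 2 then bandwidth d (i + 1) ^ d else 0) =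
        (V 0 ⁻¹' A i).indicator (fun _ => ENNReal.ofReal (C * bandwidth d (i + 1) ^ d)) ω := by
      intro ω
      rw [ENNReal.ofReal_mul hC0]
      by_cases h : effectiveRate d (i + 1) ^ 2 ≤ V 0 ω ^ 2
      · rw [if_pos h, Set.indicator_of_mem (show ω ∈ V 0 ⁻¹' A i from h)]
      · rw [if_neg h, Set.indicator_of_notMem (show ω ∉ V 0 ⁻¹' A i from h)]
        simp
    simp only [e]
    rw [lintegral_indicator_const (hVm 0 (hA i)),
      (hXV i).measure_inter_preimage_eq_mul _ _ (hb i) (hA i),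
      (hVid i).measure_mem_eq (hA i), ← Measure.map_apply (hXm i) (hb i), hXlaw i]
    gcongr
    exact hC _ hh
  have hsum : ∑' i, P (X i ⁻¹' Metric.ball u (bandwidth d (i + 1)) ∩ V i ⁻¹' A i) ≠ ∞ := by
    refine ne_top_of_le_ne_top ?_ (ENNReal.tsum_le_tsum hP)
    rw [← lintegral_tsum fun i => ?_]
    · refine ne_top_of_le_ne_top ?_ (lintegral_mono (g := fun ω => ENNReal.ofReal C *
        ENNReal.ofReal (((d : ℝ) + 4) / 4 * V 0 ω ^ 2)) fun ω => ?_)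
      · rw [lintegral_const_mul' _ _ ENNReal.ofReal_ne_top]
        refine ENNReal.mul_ne_top ENNReal.ofReal_ne_top ?_
        exact (hV2.integrable_sq.const_mul _).lintegral_lt_top.ne
      · simp only [ENNReal.tsum_mul_left]
        gcongr
        rw [ENNReal.tsum_eq_iSup_nat]
        refine iSup_le fun N => ?_
        rw [← ENNReal.ofReal_sum_of_nonneg]
        · exact ENNReal.ofReal_le_ofReal (sum_bandwidth_pow_le d (sq_nonneg _) N)
        · intro i _
          have := bandwidth_pos d (n := i + 1) (by omega)
          split_ifs <;> positivity
    · refine Measurable.aemeasurable (Measurable.const_mul (ENNReal.measurable_ofReal.comp ?_) _)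
      exact Measurable.ite (hVm 0 (hA i)) measurable_const measurable_const
  filter_upwards [ae_eventually_notMem hsum] with ω hω
  filter_upwards [hω] with i hi hX
  by_contra hV
  refine hi ⟨by simpa [Metric.mem_ball, dist_eq_norm] using hX, ?_⟩
  change effectiveRate d (i + 1) ^ 2 ≤ V i ω ^ 2
  rw [← sq_abs (V i ω)]
  exact pow_le_pow_left₀ (effectiveRate_pos d (by omega)).le (not_lt.1 hV) 2

/-- The strong law for the truncated and centred noise. As the truncation level `r_{i+1}` is at
most `r_n` for `i < n`, the summands are bounded by `M / r_n² · 2 r_n = 2 M / r_n`. -/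
theorem ae_tendsto_truncated_noise [IsProbabilityMeasure P] (hφ : IsKernel φ)
    (hXm : ∀ i, Measurable (X i)) (hXind : iIndepFun X P) (hXlaw : ∀ i, P.map (X i) = μ)
    (hC0 : 0 ≤ C) (hC : ∀ h > 0, μ (Metric.ball u h) ≤ ENNReal.ofReal (C * h ^ d))
    {V : ℕ → Ω → ℝ} (hVm : ∀ i, Measurable (V i)) (hVind : iIndepFun V P)
    (hVid : ∀ i, IdentDistrib (V i) (V 0) P P) (hV2 : MemLp (V 0) 2 P)
    (hXV : IndepFun (fun ω i => X i ω) (fun ω i => V i ω) P) :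
    ∀ᵐ ω ∂P, Tendsto (fun n : ℕ => ∑ i ∈ Finset.range n,
      (n : ℝ)⁻¹ * scaledKernel φ (bandwidth d n) (X i ω - u) *
        (truncation (V i) (effectiveRate d (i + 1)) ω -
          ∫ ω', truncation (V i) (effectiveRate d (i + 1)) ω' ∂P)) atTop (𝓝 0) := by
  have hμ : IsProbabilityMeasure μ :=
    hXlaw 0 ▸ Measure.isProbabilityMeasure_map (hXm 0).aemeasurable
  obtain ⟨M, hM⟩ := hφ.bounded
  have hM0 : 0 ≤ M := (hφ.nonneg 0).trans (hM 0)
  let k : ℕ → EuclideanSpace ℝ (Fin d) → ℝ := fun n x =>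
    (n : ℝ)⁻¹ * scaledKernel φ (bandwidth d n) (x - u)
  have hk : ∀ n, Measurable (k n) := fun n =>
    ((measurable_scaledKernel hφ _).comp (measurable_id.sub_const u)).const_mul _
  let T : ℕ → Ω → ℝ := fun i => truncation (V i) (effectiveRate d (i + 1))
  let e : ℕ → ℝ := fun i => ∫ ω, T i ω ∂P
  let τ : ℕ → ℝ → ℝ := fun i => Set.indicator
    (Set.Ioc (-effectiveRate d (i + 1)) (effectiveRate d (i + 1))) id
  have hτ : ∀ i, Measurable (τ i) := fun i => measurable_id.indicator measurableSet_Ioc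
  have hT : ∀ i, Measurable (T i) := fun i => (hτ i).comp (hVm i)
  have hr : ∀ i, 0 < effectiveRate d (i + 1) := fun i => effectiveRate_pos d (by omega)
  have hTb : ∀ i ω, |T i ω| ≤ effectiveRate d (i + 1) := fun i ω =>
    (abs_truncation_le_bound _ _ _).trans_eq (abs_of_pos (hr i))
  have hTint : ∀ i, Integrable (T i) P := fun i =>
    .of_bound (hT i).aestronglyMeasurable _ (.of_forall (hTb i))
  have heb : ∀ i, |e i| ≤ effectiveRate d (i + 1) := fun i => by
    have := norm_integral_le_of_norm_le_const (μ := P) (f := T i) (.of_forall (hTb i))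
    simpa using this
  have hpair := iIndepFun_prodMk hXind hVind hXm hVm hXV
  have hXVi : ∀ i, IndepFun (X i) (V i) P := fun i =>
    hXV.comp (measurable_pi_apply i) (measurable_pi_apply i)
  have hfactor : ∀ (a : EuclideanSpace ℝ (Fin d) → ℝ) (b : ℝ → ℝ), Measurable a → Measurable b →
      ∀ i, ∫ ω, a (X i ω) * b (V i ω) ∂P = (∫ x, a x ∂μ) * ∫ ω, b (V i ω) ∂P := by
    intro a b ha hb i
    rw [← hXlaw i, integral_map (hXm i).aemeasurable ha.aestronglyMeasurable]
    exact ((hXVi i).comp ha hb).integral_fun_mul_eq_mul_integral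
      (ha.comp (hXm i)).aestronglyMeasurable (hb.comp (hVm i)).aestronglyMeasurable
  refine ae_tendsto_sum_zero (P := P) (r := effectiveRate d)
    (fun n hn => effectiveRate_pos d hn) (fun s hs => summable_exp_neg_mul_effectiveRate d hs)
    (Z := fun n i ω => k n (X i ω) * (T i ω - e i))
    (fun n i => ((hk n).comp (hXm i)).mul ((hT i).sub_const _))
    (fun n => hpair.comp (fun i p => k n p.1 * (τ i p.2 - e i)) fun i =>
      ((hk n).comp measurable_fst).mul (((hτ i).comp measurable_snd).sub_const _))
    (B := M * 2) (C := M ^ 2 * C * ∫ ω, V 0 ω ^ 2 ∂P)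
    (fun n i hi ω => ?_) (fun n i hi => ?_) (fun n i hi => ?_)
  · have hn : 1 ≤ n := by omega
    have hrn := effectiveRate_pos d hn
    have hk0 : 0 ≤ k n (X i ω) :=
      mul_nonneg (by positivity) (scaledKernel_nonneg hφ (bandwidth_pos d hn).le _)
    have hmono : effectiveRate d (i + 1) ≤ effectiveRate d n := effectiveRate_mono d hi
    have h2 : |T i ω - e i| ≤ 2 * effectiveRate d n := by
      have := abs_sub (T i ω) (e i)
      linarith [hTb i ω, heb i]
    rw [abs_mul, abs_of_nonneg hk0]
    calc k n (X i ω) * |T i ω - e i|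
        ≤ M / effectiveRate d n ^ 2 * (2 * effectiveRate d n) := by
          gcongr
          exact inv_mul_scaledKernel_le hM hn _
      _ = M * 2 / effectiveRate d n := by field_simp
  · have := hfactor (k n) (fun v => τ i v - e i) (hk n) ((hτ i).sub_const _) i
    refine this.trans ?_
    have h0 : ∫ ω, (τ i (V i ω) - e i) ∂P = 0 := by
      change ∫ ω, (T i ω - e i) ∂P = 0
      rw [integral_sub (hTint i) (integrable_const _)]
      simp [e]
    rw [h0, mul_zero]
  · have hn : 1 ≤ n := by omega
    have h1 : ∫ ω, (τ i (V i ω) - e i) ^ 2 ∂P ≤ ∫ ω, V 0 ω ^ 2 ∂P := by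
      refine (integral_sub_integral_sq_le (hT i)).trans ?_
      have hid : ∫ ω, V i ω ^ 2 ∂P = ∫ ω, V 0 ω ^ 2 ∂P :=
        ((hVid i).comp (u := fun v : ℝ => v ^ 2) (measurable_id.pow_const 2)).integral_eq
      rw [← hid]
      refine integral_mono_of_nonneg (.of_forall fun ω => sq_nonneg _)
        (((hVid i).memLp_iff).2 hV2).integrable_sq (.of_forall fun ω => ?_)
      exact sq_le_sq.2 (abs_truncation_le_abs_self _ _ _)
    have h2 := integral_sq_inv_mul_scaledKernel_le (u := u) hφ hM hC0 hC hn
    have h3 := hfactor (fun x => k n x ^ 2) (fun v => (τ i v - e i) ^ 2) ((hk n).pow_const 2)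
      (((hτ i).sub_const _).pow_const 2) i
    calc ∫ ω, (k n (X i ω) * (T i ω - e i)) ^ 2 ∂P
        = (∫ x, k n x ^ 2 ∂μ) * ∫ ω, (τ i (V i ω) - e i) ^ 2 ∂P := by
          rw [← h3]; simp only [mul_pow]; rfl
      _ ≤ M ^ 2 * C / (n * effectiveRate d n ^ 2) * ∫ ω, V 0 ω ^ 2 ∂P := by
          gcongr
      _ = _ := by ring

/-- The kernel average of real noise with finite variance tends to zero: up to the truncated and
centred part, what remains are the means of the truncated variables and finitely many exceptional
variables, and Toeplitz's lemma applies to both. -/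
theorem ae_tendsto_noise_average [IsProbabilityMeasure P] (hφ : IsKernel φ)
    (hXm : ∀ i, Measurable (X i)) (hXind : iIndepFun X P) (hXlaw : ∀ i, P.map (X i) = μ)
    (hC0 : 0 ≤ C) (hC : ∀ h > 0, μ (Metric.ball u h) ≤ ENNReal.ofReal (C * h ^ d)) {g : ℝ}
    (hg : Tendsto (fun n => ∫ x, scaledKernel φ (bandwidth d n) (x - u) ∂μ) atTop (𝓝 g))
    {V : ℕ → Ω → ℝ} (hVm : ∀ i, Measurable (V i)) (hVind : iIndepFun V P)
    (hVid : ∀ i, IdentDistrib (V i) (V 0) P P) (hV2 : MemLp (V 0) 2 P)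
    (hVmean : ∫ ω, V 0 ω ∂P = 0)
    (hXV : IndepFun (fun ω i => X i ω) (fun ω i => V i ω) P) :
    ∀ᵐ ω ∂P, Tendsto (fun n : ℕ => ∑ i ∈ Finset.range n,
      (n : ℝ)⁻¹ * scaledKernel φ (bandwidth d n) (X i ω - u) * V i ω) atTop (𝓝 0) := by
  obtain ⟨M, hM⟩ := hφ.bounded
  have hmean : Tendsto (fun i => ∫ ω, truncation (V i) (effectiveRate d (i + 1)) ω ∂P) atTop
      (𝓝 0) := by
    have h := (tendsto_integral_truncation (hV2.integrable one_le_two)).comp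
      ((tendsto_effectiveRate d).comp (tendsto_add_atTop_nat 1))
    rw [hVmean] at h
    refine h.congr fun i => ?_
    exact ((hVid i).truncation (A := effectiveRate d (i + 1))).integral_eq.symm
  filter_upwards [ae_tendsto_density_estimate hφ hXm hXind hXlaw hC0 hC hg,
    ae_tendsto_truncated_noise hφ hXm hXind hXlaw hC0 hC hVm hVind hVid hV2 hXV,
    ae_eventually_abs_lt_of_near hXm hXlaw hC0 hC hVm hVid hV2
      fun i => hXV.comp (measurable_pi_apply i) (measurable_pi_apply i)] with ω h1 h2 h3
  obtain ⟨N, hN⟩ := eventually_atTop.1 h3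
  let w : ℕ → ℕ → ℝ := fun n i => (n : ℝ)⁻¹ * scaledKernel φ (bandwidth d n) (X i ω - u)
  let T : ℕ → ℝ := fun i => truncation (V i) (effectiveRate d (i + 1)) ω
  let e : ℕ → ℝ := fun i => ∫ ω, truncation (V i) (effectiveRate d (i + 1)) ω ∂P
  let a : ℕ → ℝ := fun i => e i + if i < N then V i ω - T i else 0
  have ha : Tendsto a atTop (𝓝 0) := by
    refine hmean.congr' ?_
    filter_upwards [eventually_ge_atTop N] with i hi
    simp [a, e, not_lt.2 hi]
  have hw : ∀ n i, 0 ≤ w n i := fun n i => mul_nonneg (by positivity)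
    (scaledKernel_nonneg hφ (Real.rpow_nonneg n.cast_nonneg _) _)
  have hw0 : ∀ i, Tendsto (fun n => w n i) atTop (𝓝 0) := by
    intro i
    have hlim : Tendsto (fun n => M / effectiveRate d n ^ 2) atTop (𝓝 0) :=
      ((tendsto_pow_atTop two_ne_zero).comp (tendsto_effectiveRate d)).const_div_atTop M
    refine squeeze_zero' (.of_forall fun n => hw n i) ?_ hlim
    filter_upwards [eventually_ge_atTop 1] with n hn
    exact inv_mul_scaledKernel_le hM hn _
  have hbd : ∀ᶠ n in atTop, ∑ i ∈ Finset.range n, w n i ≤ g + 1 := by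
    filter_upwards [h1.eventually (gt_mem_nhds (lt_add_one g))] with n hn
    rw [Finset.mul_sum] at hn
    exact hn.le
  have hsum := h2.add (tendsto_weighted_sum_zero hw hbd hw0 ha)
  rw [add_zero] at hsum
  refine hsum.congr fun n => ?_
  rw [← Finset.sum_add_distrib]
  refine Finset.sum_congr rfl fun i hi => ?_
  have hin : i < n := Finset.mem_range.1 hi
  change w n i * (T i - e i) + w n i * a i = w n i * V i ω
  simp only [a]
  split_ifs with hiN
  · ring
  -- a point of positive weight in row `n` satisfies `‖X i ω - u‖ < h_n ≤ h_{i+1}`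
  · rcases lt_or_ge ‖X i ω - u‖ (bandwidth d n) with h | h
    · have : T i = V i ω := truncation_eq_self
        (hN i (not_lt.1 hiN) (h.trans_le (bandwidth_le_bandwidth d (by omega) hin)))
      rw [this]; ring
    · have : w n i = 0 := by
        simp only [w, scaledKernel_eq_zero hφ (bandwidth_pos d (by omega : 1 ≤ n)) h, mul_zero]
      rw [this]; ring

end LawOfLargeNumbers

/-! ### Convergence of the set estimates -/

section Sets

/-- If each of `C n` and `L` lies in the `δ n`-neighbourhood of the other and `δ n → 0`, then
`C n` tends to `L` in the sense of Painlevé and Kuratowski. -/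
theorem setTendsto_of_dist_le {E : Type*} [PseudoMetricSpace E] {C : ℕ → Set E} {L : Set E}
    (hL : IsClosed L) {δ : ℕ → ℝ} (hδ : Tendsto δ atTop (𝓝 0))
    (hCL : ∀ᶠ n in atTop, ∀ y ∈ C n, ∃ p ∈ L, dist p y ≤ δ n)
    (hLC : ∀ᶠ n in atTop, ∀ p ∈ L, ∃ y ∈ C n, dist y p ≤ δ n) : SetTendsto C L := by
  have h1 : outerLimit C ⊆ L := by
    rintro x ⟨n, hn, y, hy, hyx⟩
    have hev : ∀ᶠ k in atTop, ∃ p ∈ L, dist p (y k) ≤ δ (n k) := by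
      filter_upwards [hn.tendsto_atTop.eventually hCL] with k hk
      exact hk _ (hy k)
    refine hL.closure_subset (Metric.mem_closure_iff.2 fun ε hε => ?_)
    have hd := hδ.comp hn.tendsto_atTop
    obtain ⟨k, ⟨p, hp, hpk⟩, hk1, hk2⟩ := (hev.and ((hd.eventually (gt_mem_nhds (half_pos hε))).and
      (Metric.tendsto_nhds.1 hyx _ (half_pos hε)))).exists
    refine ⟨p, hp, ?_⟩
    calc dist x p ≤ dist (y k) x + dist p (y k) := by
          rw [dist_comm (y k) x, dist_comm p]; exact dist_triangle _ _ _
      _ < ε := by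
          simp only [Function.comp] at hk1
          linarith
  have h2 : L ⊆ innerLimit C := by
    intro p hp
    have hev : ∀ᶠ n in atTop, ∃ y ∈ C n, dist y p ≤ δ n := hLC.mono fun n hn => hn p hp
    obtain ⟨y, hy⟩ := hev.choice
    refine ⟨y, hy.mono fun n hn => hn.1, tendsto_iff_dist_tendsto_zero.2 ?_⟩
    exact squeeze_zero' (.of_forall fun _ => dist_nonneg) (hy.mono fun n hn => hn.2) hδ
  have h3 : innerLimit C ⊆ outerLimit C := by
    rintro x ⟨y, hy, hyx⟩
    obtain ⟨N, hN⟩ := eventually_atTop.1 hy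
    exact ⟨fun k => k + N, fun a b h => by simpa using h, fun k => y (k + N),
      fun k => hN _ (Nat.le_add_left N k), hyx.comp (tendsto_add_atTop_nat N)⟩
  exact ⟨h1.antisymm (h2.trans h3), (h3.trans h1).antisymm h2⟩

theorem SetLipschitzOn.exists_dist_le {E F : Type*} [NormedAddCommGroup E] [NormedAddCommGroup F]
    [NormedSpace ℝ F] {S : E → Set F} {U : Set E} {κ : ℝ} (h : SetLipschitzOn S U κ)
    {x x' : E} (hx : x ∈ U) (hx' : x' ∈ U) {s : F} (hs : s ∈ S x') :
    ∃ p ∈ S x, dist s p ≤ κ * ‖x' - x‖ := by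
  obtain ⟨p, hp, _, ⟨b, hb, rfl⟩, rfl⟩ := h.subset x hx x' hx' hs
  refine ⟨p, hp, ?_⟩
  have h0 : 0 ≤ κ * ‖x' - x‖ := mul_nonneg h.const_nonneg (norm_nonneg _)
  simp only [dist_eq_norm, add_sub_cancel_left, norm_smul, Real.norm_of_nonneg h0]
  exact mul_le_of_le_one_right h0 (mem_closedBall_zero_iff.1 hb)

variable {d q : ℕ}

/-- The points of the estimate are the normalized averages of selections from the observed
sets. -/
theorem mem_kernelEstimate {φ : ℝ → ℝ} {h : ℝ} {n : ℕ} {x : ℕ → EuclideanSpace ℝ (Fin d)}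
    {S : EuclideanSpace ℝ (Fin d) → Set (EuclideanSpace ℝ (Fin q))}
    {w : ℕ → EuclideanSpace ℝ (Fin q)} {u : EuclideanSpace ℝ (Fin d)}
    {y : EuclideanSpace ℝ (Fin q)} :
    y ∈ kernelEstimate φ h n x (fun i => S (x i) + {w i}) u ↔
      ∃ s : ℕ → EuclideanSpace ℝ (Fin q), (∀ i < n, s i ∈ S (x i)) ∧
        y = ((n : ℝ)⁻¹ * ∑ i ∈ Finset.range n, scaledKernel φ h (x i - u))⁻¹ •
          ((n : ℝ)⁻¹ • ∑ i ∈ Finset.range n, scaledKernel φ h (x i - u) • (s i + w i)) := by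
  rw [kernelEstimate]
  constructor
  · rintro ⟨_, ⟨z, hz, rfl⟩, rfl⟩
    obtain ⟨g, hg, rfl⟩ := (Set.mem_finsetSum _ _ _).1 hz
    have hg' : ∀ i, i < n → ∃ s ∈ S (x i), scaledKernel φ h (x i - u) • (s + w i) = g i := by
      intro i hi
      obtain ⟨_, ⟨s, hs, w', hw', rfl⟩, hz⟩ := hg (Finset.mem_range.2 hi)
      rw [Set.mem_singleton_iff] at hw'
      subst hw'
      exact ⟨s, hs, hz⟩
    choose! s hs hsg using hg'
    refine ⟨s, hs, ?_⟩
    simp only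
    congr 2
    exact Finset.sum_congr rfl fun i hi => (hsg i (Finset.mem_range.1 hi)).symm
  · rintro ⟨s, hs, rfl⟩
    refine Set.smul_mem_smul_set (Set.smul_mem_smul_set ((Set.mem_finsetSum _ _ _).2
      ⟨fun i => scaledKernel φ h (x i - u) • (s i + w i), fun {i} hi => ?_, rfl⟩))
    exact Set.smul_mem_smul_set (Set.add_mem_add (hs i (Finset.mem_range.1 hi)) rfl)

/-- The normalized averages of the observations `s i + w i` and of points `p i` near `s i` differ
by at most the average of the bounds `κ r i` and the average noise, both normalized. -/
theorem dist_weighted_average_le {E : Type*} [NormedAddCommGroup E] [NormedSpace ℝ E] {n : ℕ}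
    {k r : ℕ → ℝ} {s p w : ℕ → E} {c κ : ℝ} (hc : 0 < c) (hk : ∀ i, 0 ≤ k i)
    (hsp : ∀ i < n, dist (s i) (p i) ≤ κ * r i) :
    dist (c⁻¹ • ((n : ℝ)⁻¹ • ∑ i ∈ Finset.range n, k i • (s i + w i)))
      (c⁻¹ • ((n : ℝ)⁻¹ • ∑ i ∈ Finset.range n, k i • p i)) ≤
      c⁻¹ * (κ * ((n : ℝ)⁻¹ * ∑ i ∈ Finset.range n, k i * r i) +
        ‖(n : ℝ)⁻¹ • ∑ i ∈ Finset.range n, k i • w i‖) := by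
  have hdiff : (n : ℝ)⁻¹ • ∑ i ∈ Finset.range n, k i • (s i + w i) -
      (n : ℝ)⁻¹ • ∑ i ∈ Finset.range n, k i • p i =
      (n : ℝ)⁻¹ • ∑ i ∈ Finset.range n, k i • (s i - p i) +
        (n : ℝ)⁻¹ • ∑ i ∈ Finset.range n, k i • w i := by
    rw [← smul_sub, ← smul_add, ← Finset.sum_sub_distrib, ← Finset.sum_add_distrib]
    congr 1
    exact Finset.sum_congr rfl fun i _ => by module
  rw [dist_eq_norm, ← smul_sub, hdiff, norm_smul, Real.norm_of_nonneg (by positivity)]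
  refine mul_le_mul_of_nonneg_left ((norm_add_le _ _).trans (add_le_add ?_ le_rfl)) (by positivity)
  rw [norm_smul, Real.norm_of_nonneg (by positivity), mul_left_comm]
  refine mul_le_mul_of_nonneg_left ?_ (by positivity)
  rw [Finset.mul_sum]
  refine norm_sum_le_of_le _ fun i hi => ?_
  rw [norm_smul, Real.norm_of_nonneg (hk i), mul_left_comm, ← dist_eq_norm]
  exact mul_le_mul_of_nonneg_left (hsp i (Finset.mem_range.1 hi)) (hk i)

theorem setTendsto_kernelEstimate {φ : ℝ → ℝ} (hφ : IsKernel φ)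
    {U : Set (EuclideanSpace ℝ (Fin d))}
    {S : EuclideanSpace ℝ (Fin d) → Set (EuclideanSpace ℝ (Fin q))} {κ : ℝ}
    (hS : SetLipschitzOn S U κ) {u : EuclideanSpace ℝ (Fin d)} (hu : u ∈ U)
    (hSconv : Convex ℝ (S u)) {x : ℕ → EuclideanSpace ℝ (Fin d)} (hx : ∀ i, x i ∈ U)
    {w : ℕ → EuclideanSpace ℝ (Fin q)} {h : ℕ → ℝ} (hh : ∀ n, 0 ≤ h n) {g : ℝ} (hg0 : 0 < g)
    (hg : Tendsto (fun n : ℕ => (n : ℝ)⁻¹ * ∑ i ∈ Finset.range n,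
      scaledKernel φ (h n) (x i - u)) atTop (𝓝 g))
    (hw : Tendsto (fun n : ℕ => (n : ℝ)⁻¹ • ∑ i ∈ Finset.range n,
      scaledKernel φ (h n) (x i - u) • w i) atTop (𝓝 0))
    (hb : Tendsto (fun n : ℕ => (n : ℝ)⁻¹ * ∑ i ∈ Finset.range n,
      scaledKernel φ (h n) (x i - u) * ‖x i - u‖) atTop (𝓝 0)) :
    SetTendsto (fun n => kernelEstimate φ (h n) n x (fun i => S (x i) + {w i}) u) (S u) := by
  have hδ := (hg.inv₀ hg0.ne').mul ((hb.const_mul κ).add hw.norm)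
  simp only [norm_zero, mul_zero, add_zero] at hδ
  have hpos := hg.eventually (lt_mem_nhds hg0)
  have hk : ∀ n i, 0 ≤ scaledKernel φ (h n) (x i - u) := fun n i =>
    scaledKernel_nonneg hφ (hh n) _
  have hone : ∀ n : ℕ, 0 < (n : ℝ)⁻¹ * ∑ i ∈ Finset.range n, scaledKernel φ (h n) (x i - u) →
      ((n : ℝ)⁻¹ * ∑ i ∈ Finset.range n, scaledKernel φ (h n) (x i - u))⁻¹ * (n : ℝ)⁻¹ *
        ∑ i ∈ Finset.range n, scaledKernel φ (h n) (x i - u) = 1 := fun n hn => by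
    rw [mul_assoc, inv_mul_cancel₀ hn.ne']
  refine setTendsto_of_dist_le (hS.closed u hu) hδ ?_ ?_
  · filter_upwards [hpos] with n hn y hy
    obtain ⟨s, hs, rfl⟩ := mem_kernelEstimate.1 hy
    have hp : ∀ i, i < n → ∃ p ∈ S u, dist (s i) p ≤ κ * ‖x i - u‖ := fun i hi =>
      hS.exists_dist_le hu (hx i) (hs i hi)
    choose! p hp hsp using hp
    refine ⟨_, ?_, (dist_comm _ _).trans_le (dist_weighted_average_le hn (hk n) hsp)⟩
    rw [smul_smul, Finset.smul_sum]
    simp only [smul_smul]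
    refine hSconv.sum_mem (fun i _ => ?_) ?_ fun i hi => hp i (Finset.mem_range.1 hi)
    · exact mul_nonneg (by positivity) (hk n i)
    · rw [← Finset.mul_sum]; exact hone n hn
  · filter_upwards [hpos] with n hn p hp
    have hs : ∀ i, ∃ s ∈ S (x i), dist s p ≤ κ * ‖x i - u‖ := fun i => by
      obtain ⟨s, hs, hd⟩ := hS.exists_dist_le (hx i) hu hp
      exact ⟨s, hs, by rwa [dist_comm, norm_sub_rev]⟩
    choose s hs hsp using hs
    refine ⟨_, mem_kernelEstimate.2 ⟨s, fun i _ => hs i, rfl⟩, ?_⟩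
    have hle := dist_weighted_average_le (n := n) (p := fun _ => p) (w := w) hn (hk n)
      fun i _ => hsp i
    have hmean : ((n : ℝ)⁻¹ * ∑ i ∈ Finset.range n, scaledKernel φ (h n) (x i - u))⁻¹ •
        ((n : ℝ)⁻¹ • ∑ i ∈ Finset.range n, scaledKernel φ (h n) (x i - u) • p) = p := by
      rw [← Finset.sum_smul, smul_smul, smul_smul, hone n hn, one_smul]
    rwa [hmean] at hle

end Sets

end SetRegression

theorem mainTheorem2 {d q : ℕ} {Ω : Type*} [MeasurableSpace Ω]
    (P : Measure Ω) [IsProbabilityMeasure P]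
    -- the convex compact domain and the set-valued function
    (U : Set (EuclideanSpace ℝ (Fin d))) (hUconv : Convex ℝ U) (hUcomp : IsCompact U)
    (S : EuclideanSpace ℝ (Fin d) → Set (EuclideanSpace ℝ (Fin q))) (κ : ℝ)
    (hSlip : SetRegression.SetLipschitzOn S U κ)
    (hSconv : ∀ u ∈ U, Convex ℝ (S u)) (hScomp : ∀ u ∈ U, IsCompact (S u))
    -- the i.i.d. design on `U`, with a density that is Lipschitz and positive on `U`
    (X : ℕ → Ω → EuclideanSpace ℝ (Fin d)) (hXmeas : ∀ i, Measurable (X i))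
    (hXindep : iIndepFun X P)
    (f : EuclideanSpace ℝ (Fin d) → ℝ) (Lf : ℝ≥0) (hfLip : LipschitzOnWith Lf f U)
    (hfpos : ∀ u ∈ U, 0 < f u)
    (hXlaw : ∀ i, P.map (X i) = (volume.restrict U).withDensity fun x => ENNReal.ofReal (f x))
    -- the i.i.d. noise, with zero mean and finite variance, independent of the design
    (W : ℕ → Ω → EuclideanSpace ℝ (Fin q)) (hWmeas : ∀ i, Measurable (W i))
    (hWindep : iIndepFun W P) (hWident : ∀ i, IdentDistrib (W i) (W 0) P P)
    (hWvar : MemLp (W 0) 2 P) (hWmean : ∫ ω, W 0 ω ∂P = 0)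
    (hXW : IndepFun (fun ω i => X i ω) (fun ω i => W i ω) P)
    -- the kernel
    (φ : ℝ → ℝ) (hφ : SetRegression.IsKernel φ)
    (u : EuclideanSpace ℝ (Fin d)) (hu : u ∈ U) :
    (∀ᵐ ω ∂P, Tendsto
      (fun n : ℕ => (n : ℝ)⁻¹ * ∑ i ∈ Finset.range n,
        SetRegression.scaledKernel φ (SetRegression.bandwidth d n) (X i ω - u))
      atTop (𝓝 (SetRegression.kernelMass φ U u * f u))) ∧
    (∀ᵐ ω ∂P, Tendsto
      (fun n : ℕ => (n : ℝ)⁻¹ • ∑ i ∈ Finset.range n,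
        SetRegression.scaledKernel φ (SetRegression.bandwidth d n) (X i ω - u) • W i ω)
      atTop (𝓝 0)) ∧
    (∀ᵐ ω ∂P, Tendsto
      (fun n : ℕ => (n : ℝ)⁻¹ * ∑ i ∈ Finset.range n,
        SetRegression.scaledKernel φ (SetRegression.bandwidth d n) (X i ω - u) * ‖X i ω - u‖)
      atTop (𝓝 0)) ∧
    (∀ᵐ ω ∂P, SetRegression.SetTendsto
      (fun n : ℕ => SetRegression.kernelEstimate φ (SetRegression.bandwidth d n) n
        (fun i => X i ω) (fun i => S (X i ω) + {W i ω}) u)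
      (S u)) := by
  set μ := (volume.restrict U).withDensity fun x => ENNReal.ofReal (f x) with hμ
  have hf : ContinuousOn f U := hfLip.continuousOn
  obtain ⟨C, hC0, hC⟩ := SetRegression.exists_measure_ball_le hUcomp hf hμ u
  have hg := SetRegression.tendsto_integral_scaledKernel hφ hUconv hUcomp hu hf
    (fun x hx => (hfpos x hx).le) hμ
    ((eventually_ge_atTop 1).mono fun n hn => SetRegression.bandwidth_pos d hn)
    (SetRegression.tendsto_bandwidth d)
  -- a null set `U` could not carry the law of `X 0`
  have hvol : volume U ≠ 0 := by
    intro h0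
    have hprob : IsProbabilityMeasure μ :=
      hXlaw 0 ▸ Measure.isProbabilityMeasure_map (hXmeas 0).aemeasurable
    apply IsProbabilityMeasure.ne_zero μ
    rw [hμ, Measure.restrict_eq_zero.2 h0, withDensity_zero_left]
  have hgpos : 0 < SetRegression.kernelMass φ U u * f u :=
    mul_pos (SetRegression.kernelMass_pos hφ hUconv hUcomp.isBounded hu hvol) (hfpos u hu)
  have hXU : ∀ᵐ ω ∂P, ∀ i, X i ω ∈ U := by
    refine ae_all_iff.2 fun i => ae_of_ae_map (hXmeas i).aemeasurable (p := fun x => x ∈ U) ?_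
    rw [hXlaw i]
    exact (withDensity_absolutelyContinuous _ _).ae_le (ae_restrict_mem hUcomp.measurableSet)
  have h1 := SetRegression.ae_tendsto_density_estimate hφ hXmeas hXindep hXlaw hC0 hC hg
  have h3 := h1.mono fun ω hω => SetRegression.tendsto_sum_scaledKernel_mul_norm hφ hω
  have h2 : ∀ᵐ ω ∂P, Tendsto
      (fun n : ℕ => (n : ℝ)⁻¹ • ∑ i ∈ Finset.range n,
        SetRegression.scaledKernel φ (SetRegression.bandwidth d n) (X i ω - u) • W i ω)
      atTop (𝓝 0) := by
    have hcoord : ∀ᵐ ω ∂P, ∀ j : Fin q, Tendsto (fun n : ℕ => ∑ i ∈ Finset.range n,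
        (n : ℝ)⁻¹ * SetRegression.scaledKernel φ (SetRegression.bandwidth d n) (X i ω - u) *
          W i ω j) atTop (𝓝 0) := by
      refine ae_all_iff.2 fun j => ?_
      let π : EuclideanSpace ℝ (Fin q) →L[ℝ] ℝ := EuclideanSpace.proj j
      have hπ : Measurable π := π.continuous.measurable
      have hseq : Measurable fun (v : ℕ → EuclideanSpace ℝ (Fin q)) (i : ℕ) => π (v i) :=
        measurable_pi_lambda _ fun i => hπ.comp (measurable_pi_apply i)
      refine SetRegression.ae_tendsto_noise_average hφ hXmeas hXindep hXlaw hC0 hC hg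
        (V := fun i ω => π (W i ω)) (fun i => hπ.comp (hWmeas i))
        (hWindep.comp (fun _ => π) fun _ => hπ) (fun i => (hWident i).comp hπ)
        (π.comp_memLp' hWvar) ?_ (hXW.comp measurable_id hseq)
      rw [π.integral_comp_comm (hWvar.integrable one_le_two), hWmean, map_zero]
    filter_upwards [hcoord] with ω hω
    have hpi := ((PiLp.continuous_toLp 2 fun _ : Fin q => ℝ).tendsto 0).comp
      (tendsto_pi_nhds.2 hω)
    refine hpi.congr fun n => ?_
    ext j
    simp [Finset.mul_sum, mul_assoc]
  refine ⟨h1, h2, h3, ?_⟩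
  filter_upwards [h1, h2, h3, hXU] with ω h1 h2 h3 hX
  exact SetRegression.setTendsto_kernelEstimate hφ hSlip hu (hSconv u hu) hX
    (fun n => Real.rpow_nonneg n.cast_nonneg _) hgpos h1 h2 h3
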